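/- Let $X$ be a connected $D$-dimensional Riemannian manifold (possibly with boundary or corners) with Riemannian distance $d$ and Riemannian volume $m$, let $\mu$ be a Borel probability measure on $X$ with density $h=\frac{d\mu}{dm}$, and let $T:X\to X$ be measure preserving and ergodic with respect to $\mu$. Assume: (A) there are constants $C>0$ and $0<\theta<1$ such that for all bounded Lipschitz functions $f,g:X\to\mathbb R$ and all integers $n\ge 0$ $$\left|\int f\cdot g\circ T^n\,d\mu-\int f\,d\mu\int g\,d\mu\right|\le C\theta^n\|f\|_{\mathrm{Lip}}\|g\|_{\mathrm{Lip}},$$ where $\|f\|_{\mathrm{Lip}}=\sup|f|+\mathrm{Lip}(f)$; (B) there are $r_0>0$ and $0<\delta<1$ such that $\mu\{x: r<d(x,q)<r+\epsilon\}<\epsilon^\delta$ for all $q\in X$ and all $0<\epsilon<r\le r_0$. Let $p\in X$ and $0<\alpha<D$ be such that there are constants $C_1,C_2,r_1>0$ with $C_1 d(x,p)^{-\alpha}\le h(x)\le C_2 d(x,p)^{-\alpha}$ for $m$-almost every $x$ with $0<d(x,p)<r_1$. Let $k\ge D-\alpha$, $\phi(x)=d(x,p)^{-k}$ and $S_n=\sum_{j=0}^{n-1}\phi\circ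 T^j$. Then for every $\epsilon>0$, for $\mu$-almost every $x\in X$, $$\limsup_{n\to\infty}\frac{S_n(x)}{n^{k/(D-\alpha)}(\log n)^{k/(D-\alpha)+\epsilon}}=0 \qquad\text{and}\qquad \liminf_{n\to\infty}\frac{S_n(x)}{n^{k/(D-\alpha)}\left(e^{-(\log n)^{1/2+\epsilon}}\right)^{k/(D-\alpha)}}>1 .$$ Hence, for $\mu$-almost every $x\in X$, $$\lim_{n\to\infty}\frac{\log S_n(x)}{\log n}=\frac{k}{D-\alpha}.$$ -/

import Mathlib

open MeasureTheory Filter Topology Set Bundle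
open scoped Manifold ContDiff

noncomputable section

/-- A bounded Lipschitz real function. -/
def IsBddLipschitz {X : Type*} [MetricSpace X] (f : X → ℝ) : Prop :=
  (∃ M : ℝ, ∀ x, |f x| ≤ M) ∧ ∃ K : ℝ, 0 ≤ K ∧ ∀ x y, |f x - f y| ≤ K * dist x y

/-- The Lipschitz norm `sup |f| + Lip f` of a bounded Lipschitz function. -/
def lipNorm {X : Type*} [MetricSpace X] (f : X → ℝ) : ℝ :=
  (⨆ x, |f x|) + sInf {K : ℝ | 0 ≤ K ∧ ∀ x y, |f x - f y| ≤ K * dist x y}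

/-- Exponential decay of correlations for Lipschitz functions, with constants that do not depend
on the functions. -/
def ExpDecayOfCorrelations {X : Type*} [MetricSpace X] [MeasurableSpace X]
    (T : X → X) (μ : Measure X) : Prop :=
  ∃ C θ : ℝ, 0 < C ∧ 0 < θ ∧ θ < 1 ∧
    ∀ f g : X → ℝ, IsBddLipschitz f → IsBddLipschitz g → ∀ n : ℕ,
      |(∫ x, f x * g (T^[n] x) ∂μ) - (∫ x, f x ∂μ) * (∫ x, g x ∂μ)|
        ≤ C * θ ^ n * lipNorm f * lipNorm g

/-- Thin annuli have small measure, uniformly in their centre. -/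
def ThinAnnuli {X : Type*} [MetricSpace X] [MeasurableSpace X] (μ : Measure X) : Prop :=
  ∃ r₀ δ : ℝ, 0 < r₀ ∧ 0 < δ ∧ δ < 1 ∧
    ∀ (q : X) (ε r : ℝ), 0 < ε → ε < r → r ≤ r₀ →
      μ.real {x | r < dist x q ∧ dist x q < r + ε} < ε ^ δ

/-- `h` is, near `p` and up to `m`-null sets, bounded above and below by positive multiples of
`dist x p ^ (-α)`. -/
def DensityComparableAt {X : Type*} [MetricSpace X] [MeasurableSpace X]
    (m : Measure X) (h : X → ℝ) (p : X) (α : ℝ) : Prop :=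
  ∃ C₁ C₂ r : ℝ, 0 < C₁ ∧ 0 < C₂ ∧ 0 < r ∧
    ∀ᵐ x ∂m, x ≠ p → dist x p < r →
      C₁ * dist x p ^ (-α) ≤ h x ∧ h x ≤ C₂ * dist x p ^ (-α)

/-- The Birkhoff sum `∑_{j < n} φ (T^j x)` of the observable `φ x = dist x p ^ (-k)`. The value
of `φ` at `p` itself is irrelevant for measures that do not charge `p`. -/
def distBirkhoffSum {X : Type*} [MetricSpace X] (T : X → X) (p : X) (k : ℝ) (n : ℕ) (x : X) : ℝ :=
  ∑ j ∈ Finset.range n, dist (T^[j] x) p ^ (-k)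

end

/-!
Bi-Lipschitz charts give balls around `p` Riemannian volume comparable to `r ^ D`, so the density
`dist x p ^ (-α)` makes `μ` regular at `p` with exponent `β = D - α`.

*Upper bound.* By regularity the levels `b n = n ^ (k / β) * (1 + log n) ^ (k / β + ε)` have
summable probabilities `μ {φ > b n}`, so the number of levels that `φ` exceeds is an integrable
function. Its Birkhoff sums grow at most linearly, by the maximal ergodic theorem, and since `b` is
superadditive (here `k ≥ β` enters) the Birkhoff sums of `φ` are at most `b (K * n)`.

*Lower bound.* It suffices to exhibit one close visit: the second moment method, applied to
Lipschitz bumps at `p` along a logarithmically sparse part of the orbit, shows that the orbit fails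
to enter the ball of measure about `i ^ 3 / 2 ^ i` before time `2 ^ i` with probability
`O(i ^ (-2))`, and Borel–Cantelli applies.
-/

/-- Upper Ahlfors regularity of `μ` at the single point `p`, with exponent `β`: the ball of radius
`r` around `p` has measure `O(r ^ β)` as `r → 0`. -/
def IsUpperRegularAt {X : Type*} [PseudoMetricSpace X] [MeasurableSpace X] (μ : Measure X) (p : X)
    (β : ℝ) : Prop :=
  ∃ C : ℝ, ∀ᶠ r in 𝓝[>] (0 : ℝ), μ (Metric.ball p r) ≤ ENNReal.ofReal (C * r ^ β)

/-- Lower Ahlfors regularity of `μ` at the single point `p`, with exponent `β`: the ball of radius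
`r` around `p` has measure at least a constant times `r ^ β` as `r → 0`. -/
def IsLowerRegularAt {X : Type*} [PseudoMetricSpace X] [MeasurableSpace X] (μ : Measure X) (p : X)
    (β : ℝ) : Prop :=
  ∃ c > (0 : ℝ), ∀ᶠ r in 𝓝[>] (0 : ℝ), ENNReal.ofReal (c * r ^ β) ≤ μ (Metric.ball p r)

section Charts

open Manifold
open scoped NNReal ENNReal

variable {E : Type*} [NormedAddCommGroup E] [NormedSpace ℝ E]
  {H : Type*} [TopologicalSpace H] (I : ModelWithCorners ℝ E H)

variable {I} in
theorem pathELength_comp_le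
    {E' : Type*} [NormedAddCommGroup E'] [NormedSpace ℝ E']
    {H' : Type*} [TopologicalSpace H'] {I' : ModelWithCorners ℝ E' H'}
    {M : Type*} [TopologicalSpace M] [ChartedSpace H M] [∀ x : M, ENorm (TangentSpace I x)]
    {N : Type*} [TopologicalSpace N] [ChartedSpace H' N] [∀ y : N, ENorm (TangentSpace I' y)]
    {f : M → N} {γ : ℝ → M} {s : Set M} {a b : ℝ} {C : ℝ≥0}
    (hγ : MDiff[Icc a b] γ) (hγs : MapsTo γ (Icc a b) s)
    (hf : ∀ t ∈ Icc a b, MDiffAt[s] f (γ t))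
    (hC : ∀ t ∈ Icc a b, ∀ v : TangentSpace I (γ t), ‖mfderiv[s] f (γ t) v‖ₑ ≤ C * ‖v‖ₑ) :
    pathELength I' (f ∘ γ) a b ≤ C * pathELength I γ a b := by
  rcases le_or_gt b a with hba | hab
  · have hnull : volume (Icc a b) = 0 := by simp [hba]
    rw [pathELength_eq_lintegral_mfderivWithin_Icc, setLIntegral_measure_zero _ _ hnull]
    exact zero_le
  rw [pathELength_eq_lintegral_mfderivWithin_Icc, pathELength_eq_lintegral_mfderivWithin_Icc,
    ← lintegral_const_mul' _ _ ENNReal.coe_ne_top]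
  refine setLIntegral_mono' measurableSet_Icc fun t ht ↦ ?_
  have hunique : UniqueMDiffWithinAt 𝓘(ℝ, ℝ) (Icc a b) t :=
    (uniqueDiffOn_Icc hab).uniqueMDiffOn t ht
  rw [mfderivWithin_comp t (hf t ht) (hγ t ht) hγs hunique]
  exact hC t ht _

attribute [local instance] normedAddCommGroupTangentSpaceVectorSpace
attribute [local instance] normedSpaceTangentSpaceVectorSpace

theorem edist_le_pathELength_of_contDiffOn {γ : ℝ → E} {a b : ℝ} (hab : a ≤ b)
    (hγ : ContDiffOn ℝ 1 γ (Icc a b)) : edist (γ a) (γ b) ≤ pathELength 𝓘(ℝ, E) γ a b := by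
  rw [edist_comm, edist_eq_enorm_sub, pathELength_eq_lintegral_mfderivWithin_Icc]
  refine (enorm_sub_le_lintegral_derivWithin_Icc_of_contDiffOn_Icc hγ hab).trans_eq ?_
  simp_rw [← fderivWithin_derivWithin, mfderivWithin_eq_fderivWithin]
  rfl

variable {I} in
theorem edist_extChartAt_le_mul_pathELength {M : Type*} [TopologicalSpace M] [ChartedSpace H M]
    [IsManifold I 1 M] [∀ x : M, ENorm (TangentSpace I x)] {x : M} {γ : ℝ → M} {s : Set M}
    {a b : ℝ} {C : ℝ≥0} (hab : a ≤ b) (hγ : CMDiff[Icc a b] 1 γ) (hγs : MapsTo γ (Icc a b) s)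
    (hs : s ⊆ (chartAt H x).source)
    (hC : ∀ y ∈ s, ∀ v : TangentSpace I y, ‖mfderiv% (extChartAt I x) y v‖ₑ ≤ C * ‖v‖ₑ) :
    edist (extChartAt I x (γ a)) (extChartAt I x (γ b)) ≤ C * pathELength I γ a b := calc
  edist (extChartAt I x (γ a)) (extChartAt I x (γ b))
    ≤ pathELength 𝓘(ℝ, E) (extChartAt I x ∘ γ) a b :=
      edist_le_pathELength_of_contDiffOn hab
        ((contMDiffOn_extChartAt (x := x)).comp hγ (hγs.mono_right hs)).contDiffOn
  _ ≤ C * pathELength I γ a b :=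
      pathELength_comp_le (s := univ) (hγ.mdifferentiableOn one_ne_zero) (mapsTo_univ _ _)
        (fun t ht ↦ (mdifferentiableAt_extChartAt (hs (hγs ht))).mdifferentiableWithinAt)
        (fun t ht ↦ by rw [mfderivWithin_univ]; exact hC _ (hγs ht))

theorem pathELength_lineMap (y z : E) :
    pathELength 𝓘(ℝ, E) (AffineMap.lineMap (k := ℝ) y z : ℝ → E) 0 1 = edist y z := by
  rw [← lintegral_fderiv_lineMap_eq_edist, pathELength_eq_lintegral_mfderivWithin_Icc]
  simp_rw [mfderivWithin_eq_fderivWithin]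
  rfl

section
variable {M : Type*} [PseudoMetricSpace M] [ChartedSpace H M]
  [RiemannianBundle (fun x : M ↦ TangentSpace I x)] [IsRiemannianManifold I M]

theorem exists_path_mem_ball_of_edist_lt {x y z : M} {r : ℝ} {b : ℝ≥0∞}
    (hy : y ∈ Metric.ball x r) (hyz : edist y z < b) (hb : b ≤ ENNReal.ofReal r) :
    ∃ γ : ℝ → M, γ 0 = y ∧ γ 1 = z ∧ CMDiff[Icc 0 1] 1 γ ∧ pathELength I γ 0 1 < b ∧
      MapsTo γ (Icc 0 1) (Metric.ball x (2 * r)) := by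
  rw [IsRiemannianManifold.out (I := I)] at hyz
  obtain ⟨γ, hγy, hγz, hγ, hlength⟩ := exists_lt_of_riemannianEDist_lt hyz
  refine ⟨γ, hγy, hγz, hγ, hlength, fun t ht ↦ ?_⟩
  have hdist : edist y (γ t) < ENNReal.ofReal r := calc
    edist y (γ t) = riemannianEDist I y (γ t) := IsRiemannianManifold.out _ _
    _ ≤ pathELength I γ 0 t :=
      riemannianEDist_le_pathELength (hγ.mono (Icc_subset_Icc_right ht.2)) hγy rfl ht.1
    _ ≤ pathELength I γ 0 1 := pathELength_mono le_rfl ht.2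
    _ < ENNReal.ofReal r := hlength.trans_le hb
  rw [edist_lt_ofReal] at hdist
  rw [Metric.mem_ball] at hy ⊢
  linarith [dist_triangle_left (γ t) x y]

end

section
variable {M : Type*} [PseudoMetricSpace M] [ChartedSpace H M] [IsManifold I 1 M]
  [RiemannianBundle (fun x : M ↦ TangentSpace I x)]
  [IsContinuousRiemannianBundle E (fun x : M ↦ TangentSpace I x)] [IsRiemannianManifold I M]

theorem exists_lipschitzOnWith_extChartAt_symm (x : M) :
    ∃ C > (0 : ℝ≥0), ∃ r > 0,
      Metric.ball (extChartAt I x x) r ∩ range I ⊆ (extChartAt I x).target ∧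
      LipschitzOnWith C (extChartAt I x).symm (Metric.ball (extChartAt I x x) r ∩ range I) := by
  obtain ⟨C, hC, hderiv⟩ := eventually_enorm_mfderivWithin_symm_extChartAt_lt I x
  obtain ⟨r, hr, hball⟩ := Metric.mem_nhdsWithin_iff.1
    (inter_mem (extChartAt_target_mem_nhdsWithin x) hderiv)
  refine ⟨C, hC, r, hr, hball.trans inter_subset_left, fun y hy z hz ↦ ?_⟩
  let η : ℝ → E := ⇑(AffineMap.lineMap (k := ℝ) y z)
  have hη : MapsTo η (Icc 0 1) (Metric.ball (extChartAt I x x) r ∩ range I) := fun t ht ↦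
    ((convex_ball _ _).inter I.convex_range).lineMap_mem hy hz ht
  have hη_target : MapsTo η (Icc 0 1) (extChartAt I x).target := fun t ht ↦ (hball (hη ht)).1
  have hη_smooth : CMDiff[Icc 0 1] 1 η :=
    ((ContinuousAffineMap.lineMap (R := ℝ) y z).contDiff.contDiffOn (n := 1)).contMDiffOn
  calc edist ((extChartAt I x).symm y) ((extChartAt I x).symm z)
      = riemannianEDist I ((extChartAt I x).symm y) ((extChartAt I x).symm z) :=
        IsRiemannianManifold.out _ _
    _ ≤ pathELength I ((extChartAt I x).symm ∘ η) 0 1 :=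
        riemannianEDist_le_pathELength ((contMDiffOn_extChartAt_symm x).comp hη_smooth hη_target)
          (by simp [η]) (by simp [η]) zero_le_one
    _ ≤ C * pathELength 𝓘(ℝ, E) η 0 1 :=
        pathELength_comp_le (hη_smooth.mdifferentiableOn one_ne_zero)
          (fun t ht ↦ (hη ht).2)
          (fun t ht ↦ mdifferentiableWithinAt_extChartAt_symm (hη_target ht))
          (fun t ht v ↦ (ContinuousLinearMap.le_opENorm _ v).trans
            (by gcongr; exact (hball (hη ht)).2.le))
    _ = C * edist y z := by rw [pathELength_lineMap]

theorem exists_lipschitzOnWith_extChartAt (x : M) :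
    ∃ C > (0 : ℝ≥0), ∃ r > 0, Metric.ball x r ⊆ (extChartAt I x).source ∧
      LipschitzOnWith C (extChartAt I x) (Metric.ball x r) := by
  obtain ⟨C, hC, hderiv⟩ := eventually_enorm_mfderiv_extChartAt_lt I x
  obtain ⟨r, hr, hball⟩ :=
    Metric.mem_nhds_iff.1 (inter_mem hderiv (extChartAt_source_mem_nhds (I := I) x))
  refine ⟨C, hC, r / 4, by positivity,
    (Metric.ball_subset_ball (by linarith)).trans (hball.trans inter_subset_right),
    fun y hy z hz ↦ ?_⟩
  by_contra! hlt
  have hyz : edist y z < ENNReal.ofReal (r / 2) := by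
    rw [edist_lt_ofReal]
    rw [Metric.mem_ball] at hy hz
    linarith [dist_triangle_right y z x]
  obtain ⟨γ, hγy, hγz, hγ, hlength, hγball⟩ := exists_path_mem_ball_of_edist_lt I
    (Metric.ball_subset_ball (by linarith) hy) (lt_min (ENNReal.lt_div_iff_mul_lt
      (.inl (by simpa using hC.ne')) (.inl ENNReal.coe_ne_top) |>.2 (mul_comm (C : ℝ≥0∞) _ ▸ hlt))
      hyz) (min_le_right _ _)
  rw [mul_div_cancel₀ _ two_ne_zero] at hγball
  have hbound := edist_extChartAt_le_mul_pathELength zero_le_one hγ hγball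
    (extChartAt_source I x ▸ hball.trans inter_subset_right) fun y hy v ↦
      (ContinuousLinearMap.le_opENorm _ v).trans (by gcongr; exact (hball hy).1.le)
  rw [hγy, hγz] at hbound
  refine (hbound.trans_lt ?_).false
  rw [mul_comm]
  exact ENNReal.mul_lt_of_lt_div (hlength.trans_le (min_le_left _ _))

end

end Charts

section Comparison

open scoped NNReal

variable {X Y : Type*} [PseudoMetricSpace X] [MeasurableSpace X] [PseudoMetricSpace Y]
  [MeasurableSpace Y] {μ : Measure X} {ν : Measure Y} {p : X} {q : Y} {β : ℝ}

theorem IsUpperRegularAt.of_ball_le (h : IsUpperRegularAt ν q β) {A : ℝ≥0} {B : ℝ} (hB : 0 < B)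
    (hle : ∀ᶠ r in 𝓝[>] (0 : ℝ), μ (Metric.ball p r) ≤ A * ν (Metric.ball q (B * r))) :
    IsUpperRegularAt μ p β := by
  obtain ⟨C, hC⟩ := h
  refine ⟨A * (C * B ^ β), ?_⟩
  filter_upwards [eventually_nhdsGT_zero_mul_left hB hC, hle, self_mem_nhdsWithin]
    with r hr hr' hr0
  calc μ (Metric.ball p r) ≤ A * ENNReal.ofReal (C * (B * r) ^ β) := by grw [hr', hr]
    _ = ENNReal.ofReal (A * (C * B ^ β) * r ^ β) := by
      rw [Real.mul_rpow hB.le (mem_Ioi.1 hr0).le, ← ENNReal.ofReal_coe_nnreal,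
        ← ENNReal.ofReal_mul A.coe_nonneg]
      ring_nf

theorem IsLowerRegularAt.of_ball_le (h : IsLowerRegularAt ν q β) {A : ℝ≥0} (hA : 0 < A) {B : ℝ}
    (hB : 0 < B)
    (hle : ∀ᶠ r in 𝓝[>] (0 : ℝ), ν (Metric.ball q (B * r)) ≤ A * μ (Metric.ball p r)) :
    IsLowerRegularAt μ p β := by
  obtain ⟨c, hc, hcν⟩ := h
  refine ⟨c * B ^ β / A, by positivity, ?_⟩
  filter_upwards [eventually_nhdsGT_zero_mul_left hB hcν, hle, self_mem_nhdsWithin]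
    with r hr hr' hr0
  have hA' : (0 : ℝ) < A := hA
  calc ENNReal.ofReal (c * B ^ β / A * r ^ β)
      = ENNReal.ofReal (c * (B * r) ^ β) / A := by
        rw [Real.mul_rpow hB.le (mem_Ioi.1 hr0).le, ← ENNReal.ofReal_coe_nnreal,
          ← ENNReal.ofReal_div_of_pos hA']
        ring_nf
    _ ≤ μ (Metric.ball p r) := ENNReal.div_le_of_le_mul' (hr.trans hr')

end Comparison

section Volume

open Manifold
open scoped NNReal ENNReal

theorem euclideanHausdorffMeasure_image_le {X Y : Type*} [EMetricSpace X]
    [MeasurableSpace X] [BorelSpace X] [EMetricSpace Y] [MeasurableSpace Y] [BorelSpace Y]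
    {K : ℝ≥0} {f : X → Y} {s : Set X} (h : LipschitzOnWith K f s) (d : ℕ) :
    μHE[d] (f '' s) ≤ (K : ℝ≥0∞) ^ d * μHE[d] s := by
  have hH := h.hausdorffMeasure_image_le (d := d) (by positivity)
  rw [ENNReal.rpow_natCast] at hH
  simp only [Measure.euclideanHausdorffMeasure_def, Measure.smul_apply, ENNReal.smul_def,
    smul_eq_mul]
  grw [hH]
  exact (mul_left_comm _ _ _).le

theorem ball_inter_subset_symm_image {X Y : Type*} [PseudoMetricSpace X] [PseudoMetricSpace Y]
    {e : PartialEquiv X Y} {C : ℝ≥0} (hC : 0 < C) {p : X} (r : ℝ) {s : Set X} (hp : p ∈ s)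
    (hs : Metric.ball p r ∩ s ⊆ e.source) (he : LipschitzOnWith C e (Metric.ball p r ∩ s)) :
    Metric.ball p r ∩ s ⊆ e.symm '' (Metric.ball (e p) (C * r) ∩ e.target) := by
  intro x hx
  have hr : 0 < r := Metric.nonempty_ball.1 ⟨x, hx.1⟩
  refine ⟨e x, ⟨?_, e.map_source (hs hx)⟩, e.left_inv (hs hx)⟩
  calc dist (e x) (e p) ≤ C * dist x p := he.dist_le_mul x hx p ⟨Metric.mem_ball_self hr, hp⟩
    _ < C * r := by gcongr; exact hx.1

theorem measure_ball_inter_pos_of_convex {E : Type*} [NormedAddCommGroup E] [NormedSpace ℝ E]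
    [MeasurableSpace E] (ν : Measure E) [ν.IsOpenPosMeasure] {K : Set E} (hK : Convex ℝ K)
    (hK' : (interior K).Nonempty) {x : E} (hx : x ∈ K) {r : ℝ} (hr : 0 < r) :
    0 < ν (Metric.ball x r ∩ K) := by
  have hcl : x ∈ closure (interior K) := by
    rw [hK.closure_interior_eq_closure_of_nonempty_interior hK']
    exact subset_closure hx
  have hne : (Metric.ball x r ∩ interior K).Nonempty :=
    mem_closure_iff.1 hcl _ Metric.isOpen_ball (Metric.mem_ball_self hr)
  exact ((Metric.isOpen_ball.inter isOpen_interior).measure_pos ν hne).trans_le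
    (measure_mono (inter_subset_inter_right _ interior_subset))

section AddHaar

variable {E : Type*} [NormedAddCommGroup E] [NormedSpace ℝ E] [FiniteDimensional ℝ E]
  [MeasurableSpace E] [BorelSpace E] (ν : Measure E) [ν.IsAddHaarMeasure]

theorem isUpperRegularAt_addHaar (x : E) : IsUpperRegularAt ν x (Module.finrank ℝ E) := by
  refine ⟨ν.real (Metric.ball 0 1), ?_⟩
  filter_upwards [self_mem_nhdsWithin] with r (hr : 0 < r)
  rw [Measure.addHaar_ball_of_pos _ _ hr, Real.rpow_natCast, mul_comm,
    ENNReal.ofReal_mul measureReal_nonneg, ofReal_measureReal measure_ball_lt_top.ne]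

-- A convex set contains its image under every contraction centred at one of its points.
theorem isLowerRegularAt_addHaar_restrict {K : Set E} (hK : Convex ℝ K)
    (hK' : (interior K).Nonempty) {x : E} (hx : x ∈ K) :
    IsLowerRegularAt (ν.restrict K) x (Module.finrank ℝ E) := by
  have hfin : ν (Metric.ball x 1 ∩ K) ≠ ⊤ :=
    ((measure_mono inter_subset_left).trans_lt measure_ball_lt_top).ne
  refine ⟨ν.real (Metric.ball x 1 ∩ K),
    ENNReal.toReal_pos (measure_ball_inter_pos_of_convex ν hK hK' hx one_pos).ne' hfin, ?_⟩
  filter_upwards [Ioc_mem_nhdsGT (zero_lt_one' ℝ)] with r ⟨hr, hr1⟩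
  have hsub : AffineMap.homothety x r '' (Metric.ball x 1 ∩ K) ⊆ Metric.ball x r ∩ K := by
    rintro _ ⟨y, ⟨hy, hyK⟩, rfl⟩
    constructor
    · rw [Metric.mem_ball, dist_homothety_center, Real.norm_eq_abs, abs_of_pos hr]
      exact mul_lt_of_lt_one_right hr (Metric.mem_ball'.1 hy)
    · rw [AffineMap.homothety_eq_lineMap]
      exact hK.lineMap_mem hx hyK ⟨hr.le, hr1⟩
  calc ENNReal.ofReal (ν.real (Metric.ball x 1 ∩ K) * r ^ (Module.finrank ℝ E : ℝ))
      = ν (AffineMap.homothety x r '' (Metric.ball x 1 ∩ K)) := by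
        rw [Measure.addHaar_image_homothety, abs_of_pos (by positivity), mul_comm,
          Real.rpow_natCast, ENNReal.ofReal_mul (by positivity), ofReal_measureReal hfin]
    _ ≤ ν.restrict K (Metric.ball x r) := by
        rw [Measure.restrict_apply measurableSet_ball]
        exact measure_mono hsub

end AddHaar

variable {E : Type*} [NormedAddCommGroup E] [NormedSpace ℝ E] [FiniteDimensional ℝ E]
  {H : Type*} [TopologicalSpace H] (I : ModelWithCorners ℝ E H)
  {M : Type*} [MetricSpace M] [ChartedSpace H M] [IsManifold I 1 M]
  [RiemannianBundle (fun x : M ↦ TangentSpace I x)]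
  [IsContinuousRiemannianBundle E (fun x : M ↦ TangentSpace I x)]
  [IsRiemannianManifold I M] [MeasurableSpace M] [BorelSpace M] (p : M)

include I

theorem isUpperRegularAt_riemannianVolume :
    IsUpperRegularAt (μHE[Module.finrank ℝ E] : Measure M) p (Module.finrank ℝ E) := by
  borelize E
  obtain ⟨C₁, -, r₁, hr₁, -, hsymm⟩ := exists_lipschitzOnWith_extChartAt_symm I p
  obtain ⟨C₂, hC₂, r₂, hr₂, hsource, hchart⟩ := exists_lipschitzOnWith_extChartAt I p
  have hC₂' : (0 : ℝ) < C₂ := hC₂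
  refine (isUpperRegularAt_addHaar μHE[Module.finrank ℝ E] (extChartAt I p p)).of_ball_le
    (A := C₁ ^ Module.finrank ℝ E) hC₂' ?_
  filter_upwards [Ioo_mem_nhdsGT (lt_min hr₂ (div_pos hr₁ hC₂'))] with r ⟨_, hr⟩
  obtain ⟨hrr₂, hrr₁⟩ := lt_min_iff.1 hr
  have hball : Metric.ball p r ∩ univ ⊆ Metric.ball p r₂ :=
    inter_subset_left.trans (Metric.ball_subset_ball hrr₂.le)
  have hsub : Metric.ball p r ⊆
      (extChartAt I p).symm '' (Metric.ball (extChartAt I p p) (C₂ * r) ∩ range I) := by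
    have h := ball_inter_subset_symm_image hC₂ r (mem_univ p) (hball.trans hsource)
      (hchart.mono hball)
    rw [inter_univ] at h
    exact h.trans (by gcongr; exact extChartAt_target_subset_range p)
  have hmono : Metric.ball (extChartAt I p p) (C₂ * r) ∩ range I ⊆
      Metric.ball (extChartAt I p p) r₁ ∩ range I := by
    gcongr
    exact ((lt_div_iff₀' hC₂').1 hrr₁).le
  grw [hsub, euclideanHausdorffMeasure_image_le (hsymm.mono hmono), inter_subset_left,
    ENNReal.coe_pow]

theorem isLowerRegularAt_riemannianVolume :
    IsLowerRegularAt (μHE[Module.finrank ℝ E] : Measure M) p (Module.finrank ℝ E) := by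
  borelize E
  obtain ⟨C₁, hC₁, r₁, hr₁, htarget, hsymm⟩ := exists_lipschitzOnWith_extChartAt_symm I p
  obtain ⟨C₂, hC₂, r₂, hr₂, -, hchart⟩ := exists_lipschitzOnWith_extChartAt I p
  have hC₁' : (0 : ℝ) < C₁ := hC₁
  have hrange : extChartAt I p p ∈ range I :=
    extChartAt_target_subset_range p (mem_extChartAt_target p)
  refine (isLowerRegularAt_addHaar_restrict μHE[Module.finrank ℝ E] I.convex_range
    I.nonempty_interior hrange).of_ball_le (pow_pos hC₂ (Module.finrank ℝ E))
    (inv_pos.2 hC₁') ?_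
  filter_upwards [Ioo_mem_nhdsGT (lt_min hr₂ (mul_pos hC₁' hr₁))] with r ⟨_, hr⟩
  obtain ⟨hrr₂, hrr₁⟩ := lt_min_iff.1 hr
  have hball : Metric.ball (extChartAt I p p) ((C₁ : ℝ)⁻¹ * r) ∩ range I ⊆
      Metric.ball (extChartAt I p p) r₁ ∩ range I := by
    gcongr
    exact ((inv_mul_lt_iff₀ hC₁').2 hrr₁).le
  have hsub : Metric.ball (extChartAt I p p) ((C₁ : ℝ)⁻¹ * r) ∩ range I ⊆
      extChartAt I p '' Metric.ball p r := by
    have h := ball_inter_subset_symm_image (e := (extChartAt I p).symm) hC₁ _ hrange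
      (hball.trans htarget) (hsymm.mono hball)
    rw [extChartAt_to_inv, mul_inv_cancel_left₀ hC₁'.ne'] at h
    exact h.trans (image_mono inter_subset_left)
  rw [Measure.restrict_apply measurableSet_ball, ENNReal.coe_pow]
  grw [hsub]
  exact euclideanHausdorffMeasure_image_le (hchart.mono (Metric.ball_subset_ball hrr₂.le)) _

end Volume

section Density

open scoped NNReal ENNReal

theorem IsUpperRegularAt.measure_singleton_eq_zero {X : Type*} [PseudoMetricSpace X]
    [MeasurableSpace X] {μ : Measure X} {p : X} {β : ℝ} (h : IsUpperRegularAt μ p β)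
    (hβ : 0 < β) : μ {p} = 0 := by
  obtain ⟨C, hC⟩ := h
  have hlim : Tendsto (fun r : ℝ ↦ ENNReal.ofReal (C * r ^ β)) (𝓝[>] 0) (𝓝 0) := by
    have hcont : Continuous fun r : ℝ ↦ ENNReal.ofReal (C * r ^ β) :=
      ENNReal.continuous_ofReal.comp
        (continuous_const.mul (Real.continuous_rpow_const hβ.le))
    simpa [Real.zero_rpow hβ.ne'] using (hcont.tendsto 0).mono_left nhdsWithin_le_nhds
  refine le_antisymm (ge_of_tendsto hlim ?_) zero_le
  filter_upwards [hC, self_mem_nhdsWithin] with r hr hr0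
  exact (measure_mono (singleton_subset_iff.2 (Metric.mem_ball_self hr0))).trans hr

theorem ball_subset_iUnion_closedBall_diff {X : Type*} [MetricSpace X] (p : X) (r : ℝ) :
    Metric.ball p r ⊆ {p} ∪ ⋃ i : ℕ,
      Metric.closedBall p (r * (1 / 2) ^ i) \ Metric.closedBall p (r * (1 / 2) ^ i / 2) := by
  intro x hx
  rcases eq_or_ne x p with rfl | hxp
  · exact .inl rfl
  have hr : 0 < r := Metric.nonempty_ball.1 ⟨x, hx⟩
  obtain ⟨i, hlt, hle⟩ := exists_nat_pow_near_of_lt_one (x := dist x p / r) (y := 1 / 2)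
    (div_pos (dist_pos.2 hxp) hr) ((div_le_one hr).2 (Metric.mem_ball.1 hx).le)
    one_half_pos one_half_lt_one
  rw [lt_div_iff₀' hr, pow_succ, ← mul_assoc, mul_one_div] at hlt
  rw [div_le_iff₀' hr] at hle
  exact .inr (mem_iUnion.2 ⟨i, hle, not_le.2 hlt⟩)

theorem isUpperRegularAt_of_annulus_le {X : Type*} [MetricSpace X] [MeasurableSpace X]
    {μ : Measure X} {p : X} {β B : ℝ} (hβ : 0 < β) (hp : μ {p} = 0)
    (hB : ∀ᶠ r in 𝓝[>] (0 : ℝ),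
      μ (Metric.closedBall p r \ Metric.closedBall p (r / 2)) ≤ ENNReal.ofReal (B * r ^ β)) :
    IsUpperRegularAt μ p β := by
  obtain ⟨r₀, hr₀, hr₀B⟩ := mem_nhdsGT_iff_exists_Ioc_subset.1 hB
  set q : ℝ := (1 / 2) ^ β with hq
  have hq0 : 0 < q := by positivity
  have hq1 : q < 1 := Real.rpow_lt_one one_half_pos.le one_half_lt_one hβ
  refine ⟨B / (1 - q), ?_⟩
  filter_upwards [Ioc_mem_nhdsGT hr₀] with r ⟨hr, hrr₀⟩
  have hannulus (i : ℕ) : μ (Metric.closedBall p (r * (1 / 2) ^ i) \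
      Metric.closedBall p (r * (1 / 2) ^ i / 2)) ≤
        ENNReal.ofReal (B * r ^ β) * ENNReal.ofReal q ^ i := by
    have hle : r * (1 / 2) ^ i ≤ r :=
      mul_le_of_le_one_right hr.le (pow_le_one₀ one_half_pos.le one_half_lt_one.le)
    refine (hr₀B ⟨by positivity, hle.trans hrr₀⟩).trans_eq ?_
    rw [Real.mul_rpow hr.le (by positivity), ← Real.rpow_pow_comm one_half_pos.le, ← hq,
      ← mul_assoc, ENNReal.ofReal_mul' (by positivity), ENNReal.ofReal_pow hq0.le]
  calc μ (Metric.ball p r)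
      ≤ μ {p} + ∑' i : ℕ, μ (Metric.closedBall p (r * (1 / 2) ^ i) \
          Metric.closedBall p (r * (1 / 2) ^ i / 2)) := by
        grw [ball_subset_iUnion_closedBall_diff p r, measure_union_le, measure_iUnion_le]
    _ ≤ ∑' i : ℕ, ENNReal.ofReal (B * r ^ β) * ENNReal.ofReal q ^ i := by
        rw [hp, zero_add]
        exact ENNReal.tsum_le_tsum hannulus
    _ = ENNReal.ofReal (B / (1 - q) * r ^ β) := by
        rw [ENNReal.tsum_mul_left, ENNReal.tsum_geometric, ← ENNReal.ofReal_one,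
          ← ENNReal.ofReal_sub _ hq0.le, ← ENNReal.ofReal_inv_of_pos (sub_pos.2 hq1),
          ← ENNReal.ofReal_mul' (inv_nonneg.2 (sub_nonneg.2 hq1.le))]
        ring_nf

variable {X : Type*} [MetricSpace X] [MeasurableSpace X] [OpensMeasurableSpace X]
  {m : Measure X} {h : X → ℝ} {p : X} {α d : ℝ}

theorem DensityComparableAt.isLowerRegularAt_withDensity (hp : DensityComparableAt m h p α)
    (hα : 0 ≤ α) (hmp : m {p} = 0) (hm : IsLowerRegularAt m p d) :
    IsLowerRegularAt (m.withDensity fun x ↦ ENNReal.ofReal (h x)) p (d - α) := by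
  obtain ⟨C₁, _, ρ, hC₁, -, hρ, hdens⟩ := hp
  obtain ⟨c, hc, hcm⟩ := hm
  refine ⟨C₁ * c, mul_pos hC₁ hc, ?_⟩
  filter_upwards [hcm, Ioc_mem_nhdsGT hρ] with r hr ⟨hr0, hrρ⟩
  have hlower : ∀ᵐ x ∂m, x ∈ Metric.ball p r →
      ENNReal.ofReal (C₁ * r ^ (-α)) ≤ ENNReal.ofReal (h x) := by
    filter_upwards [hdens, compl_mem_ae_iff.2 hmp] with x hx hxp hxr
    rw [Metric.mem_ball] at hxr
    refine ENNReal.ofReal_le_ofReal (le_trans ?_ (hx hxp (hxr.trans_le hrρ)).1)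
    gcongr ?_ * ?_
    exact Real.rpow_le_rpow_of_nonpos (dist_pos.2 hxp) hxr.le (neg_nonpos.2 hα)
  calc ENNReal.ofReal (C₁ * c * r ^ (d - α))
      = ENNReal.ofReal (C₁ * r ^ (-α)) * ENNReal.ofReal (c * r ^ d) := by
        rw [← ENNReal.ofReal_mul (by positivity), sub_eq_neg_add, Real.rpow_add hr0]
        ring_nf
    _ ≤ ∫⁻ _ in Metric.ball p r, ENNReal.ofReal (C₁ * r ^ (-α)) ∂m := by
        grw [setLIntegral_const, hr]
    _ ≤ m.withDensity (fun x ↦ ENNReal.ofReal (h x)) (Metric.ball p r) := by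
        rw [withDensity_apply _ measurableSet_ball]
        exact setLIntegral_mono_ae' measurableSet_ball hlower

theorem DensityComparableAt.isUpperRegularAt_withDensity (hp : DensityComparableAt m h p α)
    (hα : 0 ≤ α) (hαd : α < d) (hm : IsUpperRegularAt m p d) :
    IsUpperRegularAt (m.withDensity fun x ↦ ENNReal.ofReal (h x)) p (d - α) := by
  have hmp : m {p} = 0 := hm.measure_singleton_eq_zero (hα.trans_lt hαd)
  obtain ⟨_, C₂, ρ, -, hC₂, hρ, hdens⟩ := hp
  obtain ⟨C, hC⟩ := hm
  refine isUpperRegularAt_of_annulus_le (B := C₂ * 2 ^ α * (C * 2 ^ d)) (sub_pos.2 hαd)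
    (withDensity_absolutelyContinuous _ _ hmp) ?_
  filter_upwards [eventually_nhdsGT_zero_mul_left two_pos hC, Ioo_mem_nhdsGT hρ]
    with r hr ⟨hr0, hrρ⟩
  set A := Metric.closedBall p r \ Metric.closedBall p (r / 2)
  have hA : MeasurableSet A := measurableSet_closedBall.diff measurableSet_closedBall
  have hupper : ∀ᵐ x ∂m, x ∈ A → ENNReal.ofReal (h x) ≤ ENNReal.ofReal (C₂ * (r / 2) ^ (-α)) := by
    filter_upwards [hdens, compl_mem_ae_iff.2 hmp] with x hx hxp hxA
    refine ENNReal.ofReal_le_ofReal ((hx hxp (hxA.1.trans_lt hrρ)).2.trans ?_)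
    gcongr ?_ * ?_
    exact Real.rpow_le_rpow_of_nonpos (half_pos hr0) (not_le.1 hxA.2).le (neg_nonpos.2 hα)
  have hmA : m A ≤ ENNReal.ofReal (C * (2 * r) ^ d) :=
    (measure_mono (sdiff_subset.trans (Metric.closedBall_subset_ball (by linarith)))).trans hr
  calc m.withDensity (fun x ↦ ENNReal.ofReal (h x)) A
      ≤ ENNReal.ofReal (C₂ * (r / 2) ^ (-α)) * m A := by
        rw [withDensity_apply _ hA, ← setLIntegral_const]
        exact setLIntegral_mono_ae' hA hupper
    _ ≤ ENNReal.ofReal (C₂ * 2 ^ α * (C * 2 ^ d) * r ^ (d - α)) := by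
        grw [hmA, ← ENNReal.ofReal_mul (by positivity)]
        refine le_of_eq ?_
        rw [Real.div_rpow hr0.le two_pos.le, Real.mul_rpow two_pos.le hr0.le,
          Real.rpow_neg two_pos.le, div_inv_eq_mul, sub_eq_neg_add, Real.rpow_add hr0]
        ring_nf

end Density

section MaximalErgodic

theorem integral_comp_measurePreserving {X Y G : Type*} [MeasurableSpace X] [MeasurableSpace Y]
    [NormedAddCommGroup G] [NormedSpace ℝ G] {μ : Measure X} {ν : Measure Y} {T : X → Y}
    {f : Y → G} (hT : MeasurePreserving T μ ν) (hf : AEStronglyMeasurable f ν) :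
    ∫ x, f (T x) ∂μ = ∫ y, f y ∂ν := by
  rw [← integral_map hT.measurable.aemeasurable (by rwa [hT.map_eq]), hT.map_eq]

variable {X : Type*}

/-- The running maximum `max (0, f, f + f ∘ T, …)` of the Birkhoff sums of length at most `n`, in
the recursive form on which the maximal ergodic theorem rests. -/
def maxBirkhoffSum (T : X → X) (f : X → ℝ) : ℕ → X → ℝ
  | 0 => fun _ ↦ 0
  | n + 1 => fun x ↦ max 0 (f x + maxBirkhoffSum T f n (T x))

theorem maxBirkhoffSum_nonneg (T : X → X) (f : X → ℝ) (n : ℕ) (x : X) :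
    0 ≤ maxBirkhoffSum T f n x := by
  cases n with
  | zero => exact le_rfl
  | succ n => exact le_max_left _ _

theorem monotone_maxBirkhoffSum (T : X → X) (f : X → ℝ) : Monotone (maxBirkhoffSum T f) := by
  refine monotone_nat_of_le_succ fun n ↦ ?_
  induction n with
  | zero => exact fun x ↦ le_max_left _ _
  | succ n ih => exact fun x ↦ max_le_max le_rfl (add_le_add le_rfl (ih _))

theorem birkhoffSum_le_maxBirkhoffSum (T : X → X) (f : X → ℝ) (n : ℕ) (x : X) :
    birkhoffSum T f n x ≤ maxBirkhoffSum T f n x := by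
  induction n generalizing x with
  | zero => exact le_rfl
  | succ n ih =>
    rw [birkhoffSum_succ']
    exact le_max_of_le_right (by gcongr; exact ih _)

theorem maxBirkhoffSum_sub_le_indicator (T : X → X) (f : X → ℝ) (n : ℕ) (x : X) :
    maxBirkhoffSum T f n x - maxBirkhoffSum T f n (T x) ≤
      {x | 0 < maxBirkhoffSum T f n x}.indicator f x := by
  by_cases hx : 0 < maxBirkhoffSum T f n x
  · rw [indicator_of_mem (by exact hx)]
    cases n with
    | zero => exact absurd hx (lt_irrefl _)
    | succ n =>
      have hmono := monotone_maxBirkhoffSum T f (Nat.le_add_right n 1) (T x)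
      have hsum : 0 < f x + maxBirkhoffSum T f n (T x) :=
        (lt_max_iff.1 hx).resolve_left (lt_irrefl _)
      have hmax : maxBirkhoffSum T f (n + 1) x = f x + maxBirkhoffSum T f n (T x) :=
        max_eq_right hsum.le
      linarith
  · rw [indicator_of_notMem (by exact hx)]
    linarith [maxBirkhoffSum_nonneg T f n (T x)]

variable [MeasurableSpace X] {μ : Measure X} {T : X → X} {f : X → ℝ}

theorem measurable_maxBirkhoffSum (hT : Measurable T) (hf : Measurable f) (n : ℕ) :
    Measurable (maxBirkhoffSum T f n) := by
  induction n with
  | zero => exact measurable_const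
  | succ n ih => exact measurable_const.max (hf.add (ih.comp hT))

theorem integrable_maxBirkhoffSum (hT : MeasurePreserving T μ μ) (hf : Integrable f μ) (n : ℕ) :
    Integrable (maxBirkhoffSum T f n) μ := by
  induction n with
  | zero => exact integrable_zero _ _ _
  | succ n ih => exact (integrable_zero _ _ _).sup (hf.add (hT.integrable_comp_of_integrable ih))

theorem setIntegral_maxBirkhoffSum_pos_nonneg (hT : MeasurePreserving T μ μ)
    (hfm : Measurable f) (hf : Integrable f μ) (n : ℕ) :
    0 ≤ ∫ x in {x | 0 < maxBirkhoffSum T f n x}, f x ∂μ := by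
  set M := maxBirkhoffSum T f n
  have hM : Measurable M := measurable_maxBirkhoffSum hT.measurable hfm n
  have hMi : Integrable M μ := integrable_maxBirkhoffSum hT hf n
  have hMT : Integrable (fun x ↦ M (T x)) μ := hT.integrable_comp_of_integrable hMi
  have hA : MeasurableSet {x | 0 < M x} := measurableSet_lt measurable_const hM
  have hinvariant : ∫ x, M (T x) ∂μ = ∫ x, M x ∂μ :=
    integral_comp_measurePreserving hT hM.aestronglyMeasurable
  calc 0 = ∫ x, (M x - M (T x)) ∂μ := by rw [integral_sub hMi hMT, hinvariant, sub_self]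
    _ ≤ ∫ x, {x | 0 < M x}.indicator f x ∂μ :=
      integral_mono (hMi.sub hMT) (hf.indicator hA) (maxBirkhoffSum_sub_le_indicator T f n)
    _ = ∫ x in {x | 0 < M x}, f x ∂μ := integral_indicator hA

variable [IsFiniteMeasure μ]

theorem measure_maxBirkhoffSum_sub_const_pos_le (hT : MeasurePreserving T μ μ) (hfm : Measurable f)
    (hf : Integrable f μ) {L : ℝ} (hL : 0 < L) (n : ℕ) :
    μ {x | 0 < maxBirkhoffSum T (fun x ↦ f x - L) n x} ≤
      ENNReal.ofReal ((∫ x, |f x| ∂μ) / L) := by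
  set A := {x | 0 < maxBirkhoffSum T (fun x ↦ f x - L) n x}
  have hmax := setIntegral_maxBirkhoffSum_pos_nonneg hT (hfm.sub_const L)
    (hf.sub (integrable_const L)) n
  rw [integral_sub hf.integrableOn (integrable_const L).integrableOn, setIntegral_const,
    smul_eq_mul, sub_nonneg] at hmax
  have hAf : ∫ x in A, f x ∂μ ≤ ∫ x, |f x| ∂μ :=
    (integral_mono hf.integrableOn hf.abs.integrableOn fun x ↦ le_abs_self _).trans
      (setIntegral_le_integral hf.abs (ae_of_all _ fun x ↦ abs_nonneg _))
  rw [← ofReal_measureReal (measure_ne_top μ A)]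
  exact ENNReal.ofReal_le_ofReal ((le_div_iff₀ hL).2 (hmax.trans hAf))

theorem measure_exists_lt_birkhoffSum_le (hT : MeasurePreserving T μ μ) (hfm : Measurable f)
    (hf : Integrable f μ) {L : ℝ} (hL : 0 < L) :
    μ {x | ∃ n : ℕ, L * n < birkhoffSum T f n x} ≤ ENNReal.ofReal ((∫ x, |f x| ∂μ) / L) := by
  set A : ℕ → Set X := fun n ↦ {x | 0 < maxBirkhoffSum T (fun x ↦ f x - L) n x}
  have hA : Monotone A := fun m n hmn x hx ↦ lt_of_lt_of_le hx (monotone_maxBirkhoffSum _ _ hmn x)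
  have hsub : {x | ∃ n : ℕ, L * n < birkhoffSum T f n x} ⊆ ⋃ n, A n := by
    rintro x ⟨n, hn⟩
    refine mem_iUnion.2 ⟨n, lt_of_lt_of_le ?_ (birkhoffSum_le_maxBirkhoffSum _ _ n x)⟩
    simpa [birkhoffSum, mul_comm] using hn
  grw [hsub, hA.measure_iUnion]
  exact iSup_le (measure_maxBirkhoffSum_sub_const_pos_le hT hfm hf hL)

theorem ae_exists_birkhoffSum_le_mul (hT : MeasurePreserving T μ μ) (hfm : Measurable f)
    (hf : Integrable f μ) : ∀ᵐ x ∂μ, ∃ K : ℕ, ∀ n : ℕ, birkhoffSum T f n x ≤ K * n := by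
  have hlim : Tendsto (fun K : ℕ ↦ ENNReal.ofReal ((∫ x, |f x| ∂μ) / K)) atTop (𝓝 0) := by
    simpa using ENNReal.tendsto_ofReal (tendsto_const_div_atTop_nhds_zero_nat (∫ x, |f x| ∂μ))
  rw [ae_iff]
  refine le_antisymm (ge_of_tendsto hlim ?_) zero_le
  filter_upwards [eventually_gt_atTop 0] with K hK
  refine (measure_mono fun x hx ↦ ?_).trans
    (measure_exists_lt_birkhoffSum_le hT hfm hf (Nat.cast_pos.2 hK))
  simp only [mem_ofPred_eq, not_exists, not_forall, not_le] at hx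
  exact hx K

end MaximalErgodic

section UpperBound

open Asymptotics
open scoped ENNReal

theorem tsum_ne_top_of_eventually_le_ofReal {f : ℕ → ℝ≥0∞} {g : ℕ → ℝ} (hf : ∀ n, f n ≠ ⊤)
    (hg : Summable g) (hfg : ∀ᶠ n in atTop, f n ≤ ENNReal.ofReal (g n)) : ∑' n, f n ≠ ⊤ := by
  have hsum : Summable fun n ↦ (f n).toReal := by
    refine .of_norm_bounded_eventually_nat hg.norm ?_
    filter_upwards [hfg] with n hn
    grw [Real.norm_of_nonneg ENNReal.toReal_nonneg, hn, ENNReal.toReal_ofReal', Real.norm_eq_abs]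
    exacts [max_le (le_abs_self _) (abs_nonneg _), ENNReal.ofReal_ne_top]
  simpa only [ENNReal.ofReal_toReal (hf _)] using hsum.tsum_ofReal_ne_top

theorem summable_inv_mul_one_add_log_rpow {q : ℝ} (hq : 1 < q) :
    Summable fun n : ℕ ↦ ((n : ℝ) * (1 + Real.log n) ^ q)⁻¹ := by
  have hlog (n : ℕ) : 0 ≤ Real.log n := Real.log_natCast_nonneg n
  refine (summable_condensed_iff_of_nonneg
    (fun n ↦ by have := hlog n; positivity) fun m n hm hmn ↦ ?_).1 ?_
  · have := hlog m
    have : (0 : ℝ) < m := Nat.cast_pos.2 hm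
    gcongr
  · have hseries : Summable fun i : ℕ ↦ (Real.log 2 ^ q)⁻¹ * ((i : ℝ) ^ q)⁻¹ :=
      (Real.summable_nat_rpow_inv.2 hq).mul_left _
    refine .of_norm_bounded_eventually_nat hseries ?_
    filter_upwards [eventually_gt_atTop 0] with i hi
    have hlog2 : 0 < Real.log 2 := Real.log_pos one_lt_two
    rw [Real.norm_of_nonneg (by have := hlog (2 ^ i); positivity), Nat.cast_pow, Nat.cast_ofNat,
      Real.log_pow, mul_inv, mul_inv_cancel_left₀ (by positivity), ← mul_inv,
      ← Real.mul_rpow hlog2.le (Nat.cast_nonneg i)]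
    gcongr
    linarith

theorem add_mul_one_add_log_rpow_le {s γ : ℝ} (hs : 1 ≤ s) (hγ : 0 ≤ γ) (m n : ℕ) :
    (m : ℝ) ^ s * (1 + Real.log m) ^ γ + (n : ℝ) ^ s * (1 + Real.log n) ^ γ ≤
      ((m + n : ℕ) : ℝ) ^ s * (1 + Real.log (m + n : ℕ)) ^ γ := by
  have hrpow : (m : ℝ) ^ s + (n : ℝ) ^ s ≤ ((m + n : ℕ) : ℝ) ^ s := by
    rw [Nat.cast_add]
    exact Real.add_rpow_le_rpow_add m.cast_nonneg n.cast_nonneg hs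
  have hlog {a b : ℕ} (hab : a ≤ b) : Real.log a ≤ Real.log b := by
    rcases Nat.eq_zero_or_pos a with rfl | ha
    · simpa using Real.log_natCast_nonneg b
    · exact Real.log_le_log (Nat.cast_pos.2 ha) (Nat.cast_le.2 hab)
  have := Real.log_natCast_nonneg m
  have := Real.log_natCast_nonneg n
  grw [hlog (Nat.le_add_right m n), hlog (Nat.le_add_left n m), ← add_mul, hrpow]

theorem sum_apply_le_apply_sum {ι : Type*} {b : ℕ → ℝ} (hb0 : 0 ≤ b 0)
    (hb : ∀ m n, b m + b n ≤ b (m + n)) (s : Finset ι) (a : ι → ℕ) :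
    ∑ i ∈ s, b (a i) ≤ b (∑ i ∈ s, a i) :=
  Finset.le_sum_of_subadditive (N := ℝᵒᵈ) b hb0 hb s a

variable {X : Type*} [MeasurableSpace X] {μ : Measure X} {T : X → X} {φ : X → ℝ} {b : ℕ → ℝ}

theorem le_of_tsum_indicator_lt_le (hb : Monotone b) {t : ℝ} {m : ℕ}
    (hm : ∑' n, {n | b n < t}.indicator 1 n ≤ (m : ℝ≥0∞)) : t ≤ b m := by
  by_contra! ht
  have hone : ∀ n ∈ Finset.range (m + 1), {n | b n < t}.indicator 1 n = (1 : ℝ≥0∞) :=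
    fun n hn ↦ indicator_of_mem (s := {n | b n < t})
      ((hb (Nat.lt_succ_iff.1 (Finset.mem_range.1 hn))).trans_lt ht) _
  have hle : ((m + 1 : ℕ) : ℝ≥0∞) ≤ m := by
    simpa [Finset.sum_congr rfl hone] using (ENNReal.sum_le_tsum (Finset.range (m + 1))).trans hm
  exact absurd (Nat.cast_le.1 hle) (Nat.not_succ_le_self m)

-- `g x` counts the levels `b n` that `φ` exceeds at `x`, so that `φ x ≤ b ⌈g x⌉`; superadditivity
-- turns the resulting bound on the Birkhoff sum into `b` of a Birkhoff sum of `⌈g⌉`, which grows at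
-- most linearly.
theorem ae_exists_birkhoffSum_le_of_superadditive [IsFiniteMeasure μ]
    (hT : MeasurePreserving T μ μ) (hφ : Measurable φ) (hb0 : ∀ n, 0 ≤ b n)
    (hb : ∀ m n, b m + b n ≤ b (m + n)) (hsum : ∑' n, μ {x | b n < φ x} ≠ ⊤) :
    ∀ᵐ x ∂μ, ∃ K : ℕ, ∀ n, birkhoffSum T φ n x ≤ b (K * n) := by
  have hmono : Monotone b := monotone_nat_of_le_succ fun n ↦ by linarith [hb n 1, hb0 1]
  have hmeas (n : ℕ) : MeasurableSet {x | b n < φ x} := measurableSet_lt measurable_const hφ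
  set g : X → ℝ≥0∞ := fun x ↦ ∑' n, {x | b n < φ x}.indicator 1 x
  have hg : Measurable g := .tsum fun n ↦ measurable_one.indicator (hmeas n)
  have hgint : ∫⁻ x, g x ∂μ ≠ ⊤ := by
    rw [lintegral_tsum fun n ↦ (measurable_one.indicator (hmeas n)).aemeasurable]
    simpa only [lintegral_indicator_one (hmeas _)] using hsum
  have hfin : ∀ᵐ x ∂μ, ∀ j : ℕ, g (T^[j] x) < ⊤ := ae_all_iff.2 fun j ↦
    (hT.iterate j).quasiMeasurePreserving.ae (ae_lt_top hg hgint)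
  filter_upwards [hfin, ae_exists_birkhoffSum_le_mul hT (hg.ennreal_toReal.add_const 1)
    ((integrable_toReal_of_lintegral_ne_top hg.aemeasurable hgint).add (integrable_const 1))]
    with x hx ⟨K, hK⟩
  refine ⟨K, fun n ↦ ?_⟩
  set N : ℕ → ℕ := fun j ↦ ⌈(g (T^[j] x)).toReal⌉₊
  have hle (j : ℕ) : φ (T^[j] x) ≤ b (N j) := by
    refine le_of_tsum_indicator_lt_le hmono ?_
    rw [← ENNReal.ofReal_natCast]
    exact (ENNReal.le_ofReal_iff_toReal_le (hx j).ne (Nat.cast_nonneg _)).2 (Nat.le_ceil _)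
  have hN : ∑ j ∈ Finset.range n, N j ≤ K * n := by
    refine Nat.cast_le (α := ℝ).1 (le_trans ?_ ((hK n).trans_eq (Nat.cast_mul K n).symm))
    rw [Nat.cast_sum]
    exact Finset.sum_le_sum fun j _ ↦ (Nat.ceil_lt_add_one ENNReal.toReal_nonneg).le
  calc birkhoffSum T φ n x ≤ ∑ j ∈ Finset.range n, b (N j) := Finset.sum_le_sum fun j _ ↦ hle j
    _ ≤ b (∑ j ∈ Finset.range n, N j) := sum_apply_le_apply_sum (hb0 0) hb _ _
    _ ≤ b (K * n) := hmono hN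

theorem distBirkhoffSum_nonneg {X : Type*} [MetricSpace X] (T : X → X) (p : X) (k : ℝ) (n : ℕ)
    (x : X) : 0 ≤ distBirkhoffSum T p k n x :=
  Finset.sum_nonneg fun _ _ ↦ Real.rpow_nonneg dist_nonneg _

theorem IsUpperRegularAt.tsum_measure_lt_dist_rpow_neg_ne_top {X : Type*} [PseudoMetricSpace X]
    [MeasurableSpace X] {μ : Measure X} [IsFiniteMeasure μ] {p : X} {β k ε : ℝ}
    (hμ : IsUpperRegularAt μ p β) (hβ : 0 < β) (hk : 0 < k) (hε : 0 < ε) :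
    ∑' n : ℕ, μ {x | (n : ℝ) ^ (k / β) * (1 + Real.log n) ^ (k / β + ε) < dist x p ^ (-k)} ≠ ⊤ := by
  obtain ⟨C, hC⟩ := hμ
  set s := k / β
  have hs : 0 < s := div_pos hk hβ
  have hq : 1 < (s + ε) / s := (one_lt_div hs).2 (lt_add_of_pos_right s hε)
  set v : ℕ → ℝ := fun n ↦ n * (1 + Real.log n) ^ ((s + ε) / s)
  have hv : Tendsto v atTop atTop := by
    refine tendsto_atTop_mono (fun n ↦ ?_) tendsto_natCast_atTop_atTop
    refine le_mul_of_one_le_right n.cast_nonneg (Real.one_le_rpow ?_ (one_pos.trans hq).le)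
    linarith [Real.log_natCast_nonneg n]
  have hr : Tendsto (fun n ↦ v n ^ (-β⁻¹)) atTop (𝓝[>] 0) := by
    refine tendsto_nhdsWithin_iff.2
      ⟨(tendsto_rpow_neg_atTop (inv_pos.2 hβ)).comp hv, ?_⟩
    filter_upwards [hv.eventually_gt_atTop 0] with n hn using Real.rpow_pos_of_pos hn _
  refine tsum_ne_top_of_eventually_le_ofReal (fun n ↦ measure_ne_top _ _)
    ((summable_inv_mul_one_add_log_rpow hq).mul_left C) ?_
  filter_upwards [hr.eventually hC, hv.eventually_gt_atTop 0] with n hn hvn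
  have hlog := Real.log_natCast_nonneg n
  have hvs : v n ^ s = (n : ℝ) ^ s * (1 + Real.log n) ^ (s + ε) := by
    rw [Real.mul_rpow n.cast_nonneg (by positivity), ← Real.rpow_mul (by positivity),
      div_mul_cancel₀ _ hs.ne']
  have hvβ : (v n ^ (-β⁻¹)) ^ β = (v n)⁻¹ := by
    rw [← Real.rpow_mul hvn.le, neg_mul, inv_mul_cancel₀ hβ.ne', Real.rpow_neg_one]
  rw [hvβ] at hn
  refine (measure_mono fun x hx ↦ ?_).trans hn
  rw [mem_ofPred_eq, ← hvs] at hx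
  by_contra! hdist
  rw [Metric.mem_ball, not_lt] at hdist
  refine hx.not_ge ((Real.rpow_le_rpow_of_nonpos (by positivity) hdist (by linarith)).trans_eq ?_)
  rw [← Real.rpow_mul hvn.le, neg_mul_neg, inv_mul_eq_div]

theorem isBigO_const_mul_rpow_mul_one_add_log_rpow {K : ℝ} (hK : 0 ≤ K) (s : ℝ) {γ : ℝ}
    (hγ : 0 ≤ γ) : (fun x : ℝ ↦ (K * x) ^ s * (1 + Real.log (K * x)) ^ γ) =O[atTop]
      fun x : ℝ ↦ x ^ s * Real.log x ^ γ := by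
  have hrpow : (fun x : ℝ ↦ (K * x) ^ s) =O[atTop] fun x : ℝ ↦ x ^ s := by
    refine ((isBigO_refl _ _).const_mul_left (K ^ s)).congr' ?_ .rfl
    filter_upwards [eventually_ge_atTop 0] with x hx using (Real.mul_rpow hK hx).symm
  have hlog : (fun x : ℝ ↦ 1 + Real.log (K * x)) =O[atTop] Real.log :=
    (Real.isLittleO_const_log_atTop (c := 1)).isBigO.add (Real.isBigO_log_const_mul_log_atTop K)
  exact hrpow.mul (hlog.rpow hγ (Real.tendsto_log_atTop.eventually_ge_atTop 0))

theorem IsUpperRegularAt.ae_distBirkhoffSum_isBigO {X : Type*} [MetricSpace X] [MeasurableSpace X]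
    [OpensMeasurableSpace X] {μ : Measure X} [IsFiniteMeasure μ] {T : X → X} {p : X} {β k ε : ℝ}
    (hμ : IsUpperRegularAt μ p β) (hT : MeasurePreserving T μ μ) (hβ : 0 < β) (hk : β ≤ k)
    (hε : 0 < ε) : ∀ᵐ x ∂μ, (fun n ↦ distBirkhoffSum T p k n x) =O[atTop]
      fun n : ℕ ↦ (n : ℝ) ^ (k / β) * Real.log n ^ (k / β + ε) := by
  have hs : 1 ≤ k / β := (one_le_div hβ).2 hk
  have hγ : 0 ≤ k / β + ε := by positivity
  have hb0 (n : ℕ) : 0 ≤ (n : ℝ) ^ (k / β) * (1 + Real.log n) ^ (k / β + ε) := by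
    have := Real.log_natCast_nonneg n
    positivity
  filter_upwards [ae_exists_birkhoffSum_le_of_superadditive hT (by fun_prop) hb0
    (add_mul_one_add_log_rpow_le hs hγ)
    (hμ.tsum_measure_lt_dist_rpow_neg_ne_top hβ (hβ.trans_le hk) hε)] with x ⟨K, hK⟩
  refine (IsBigO.of_norm_le fun n ↦ ?_).trans
    ((isBigO_const_mul_rpow_mul_one_add_log_rpow K.cast_nonneg (k / β) hγ).comp_tendsto
      tendsto_natCast_atTop_atTop)
  rw [Real.norm_of_nonneg (distBirkhoffSum_nonneg T p k n x)]
  exact (hK n).trans_eq (by simp only [Function.comp_apply, Nat.cast_mul])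

end UpperBound

section SecondMoment

open ProbabilityTheory

theorem variance_sum_le {Ω ι : Type*} [MeasurableSpace Ω] {μ : Measure Ω} [IsFiniteMeasure μ]
    {X : ι → Ω → ℝ} {s : Finset ι} {v δ : ℝ} (hX : ∀ i ∈ s, MemLp (X i) 2 μ) (hδ : 0 ≤ δ)
    (hvar : ∀ i ∈ s, Var[X i; μ] ≤ v)
    (hcov : ∀ i ∈ s, ∀ j ∈ s, i ≠ j → cov[X i, X j; μ] ≤ δ) :
    Var[fun x ↦ ∑ i ∈ s, X i x; μ] ≤ s.card * v + s.card ^ 2 * δ := by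
  classical
  have hle : ∀ i ∈ s, ∀ j ∈ s, cov[X i, X j; μ] ≤ (if i = j then v else 0) + δ := by
    intro i hi j hj
    split_ifs with hij
    · rw [← hij, covariance_self (hX i hi).aestronglyMeasurable.aemeasurable]
      linarith [hvar i hi]
    · linarith [hcov i hi j hj hij]
  rw [variance_fun_sum' hX]
  refine (Finset.sum_le_sum fun i hi ↦ Finset.sum_le_sum (hle i hi)).trans_eq ?_
  simp +contextual only [Finset.sum_add_distrib, Finset.sum_ite_eq, if_true, Finset.sum_const,
    nsmul_eq_mul]
  ring

theorem measure_forall_eq_zero_le {Ω ι : Type*} [MeasurableSpace Ω] {μ : Measure Ω}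
    [IsFiniteMeasure μ] {X : ι → Ω → ℝ} {s : Finset ι} {m v δ : ℝ} (hs : s.Nonempty)
    (hX : ∀ i ∈ s, MemLp (X i) 2 μ) (hm : 0 < m) (hmean : ∀ i ∈ s, μ[X i] = m) (hδ : 0 ≤ δ)
    (hvar : ∀ i ∈ s, Var[X i; μ] ≤ v)
    (hcov : ∀ i ∈ s, ∀ j ∈ s, i ≠ j → cov[X i, X j; μ] ≤ δ) :
    μ {x | ∀ i ∈ s, X i x = 0} ≤ ENNReal.ofReal (v / (s.card * m ^ 2) + δ / m ^ 2) := by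
  have : (0 : ℝ) < s.card := Nat.cast_pos.2 hs.card_pos
  have hmeanSum : ∫ x, ∑ i ∈ s, X i x ∂μ = s.card * m := by
    rw [integral_finsetSum s fun i hi ↦ (hX i hi).integrable one_le_two, Finset.sum_congr rfl hmean,
      Finset.sum_const, nsmul_eq_mul]
  calc μ {x | ∀ i ∈ s, X i x = 0}
      ≤ μ {x | s.card * m ≤ |∑ i ∈ s, X i x - ∫ x, ∑ i ∈ s, X i x ∂μ|} := by
        refine measure_mono fun x hx ↦ ?_
        rw [mem_ofPred_eq, hmeanSum, Finset.sum_eq_zero hx, zero_sub, abs_neg]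
        exact le_abs_self _
    _ ≤ ENNReal.ofReal (Var[fun x ↦ ∑ i ∈ s, X i x; μ] / (s.card * m) ^ 2) :=
        meas_ge_le_variance_div_sq (memLp_finsetSum s hX) (by positivity)
    _ ≤ ENNReal.ofReal ((s.card * v + s.card ^ 2 * δ) / (s.card * m) ^ 2) := by
        grw [variance_sum_le hX hδ hvar hcov]
    _ = ENNReal.ofReal (v / (s.card * m ^ 2) + δ / m ^ 2) := by
        congr 1
        field_simp

variable {X : Type*} [MeasurableSpace X] {μ : Measure X} {T : X → X} {f : X → ℝ}

theorem covariance_comp_iterate [IsProbabilityMeasure μ] (hT : MeasurePreserving T μ μ)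
    (hf : MemLp f 2 μ) (a n : ℕ) :
    cov[fun x ↦ f (T^[a] x), fun x ↦ f (T^[a + n] x); μ] =
      ∫ x, f x * f (T^[n] x) ∂μ - (∫ x, f x ∂μ) * ∫ x, f x ∂μ := by
  have hmem (j : ℕ) : MemLp (fun x ↦ f (T^[j] x)) 2 μ := hf.comp_measurePreserving (hT.iterate j)
  rw [covariance_eq_sub (hmem a) (hmem _), integral_comp_measurePreserving (hT.iterate a) hf.1,
    integral_comp_measurePreserving (hT.iterate _) hf.1,
    ← integral_comp_measurePreserving (f := fun x ↦ f x * f (T^[n] x)) (hT.iterate a)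
      (hf.1.mul (hmem n).1)]
  simp only [Pi.mul_apply, ← Function.iterate_add_apply, add_comm a n]

theorem measure_forall_iterate_eq_zero_le [IsProbabilityMeasure μ] (hT : MeasurePreserving T μ μ)
    (hf : AEStronglyMeasurable f μ) (hf01 : ∀ x, f x ∈ Icc 0 1) (hpos : 0 < ∫ x, f x ∂μ) {δ : ℝ}
    (hδ : 0 ≤ δ) (hcorr : ∀ n, 0 < n →
      ∫ x, f x * f (T^[n] x) ∂μ - (∫ x, f x ∂μ) * ∫ x, f x ∂μ ≤ δ) {n : ℕ} (hn : 0 < n) :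
    μ {x | ∀ j < n, f (T^[j] x) = 0} ≤
      ENNReal.ofReal (1 / (n * ∫ x, f x ∂μ) + δ / (∫ x, f x ∂μ) ^ 2) := by
  have hmem : MemLp f 2 μ := .of_bound hf 1 (ae_of_all _ fun x ↦ by
    rw [Real.norm_of_nonneg (hf01 x).1]; exact (hf01 x).2)
  have hmemj (j : ℕ) : MemLp (fun x ↦ f (T^[j] x)) 2 μ := hmem.comp_measurePreserving (hT.iterate j)
  have hmean (j : ℕ) : ∫ x, f (T^[j] x) ∂μ = ∫ x, f x ∂μ :=
    integral_comp_measurePreserving (hT.iterate j) hf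
  have hvar (j : ℕ) : Var[fun x ↦ f (T^[j] x); μ] ≤ ∫ x, f x ∂μ := by
    grw [variance_le_expectation_sq (hmemj j).1, ← hmean j]
    refine integral_mono (hmemj j).integrable_sq ((hmemj j).integrable one_le_two) fun x ↦ ?_
    exact pow_le_of_le_one (hf01 _).1 (hf01 _).2 two_ne_zero
  have hcov (i j : ℕ) (hij : i ≠ j) : cov[fun x ↦ f (T^[i] x), fun x ↦ f (T^[j] x); μ] ≤ δ := by
    wlog hlt : i < j generalizing i j
    · rw [covariance_comm]
      exact this j i hij.symm (hij.lt_or_gt.resolve_left hlt)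
    obtain ⟨l, rfl⟩ := Nat.exists_eq_add_of_lt hlt
    rw [add_assoc, covariance_comp_iterate hT hmem]
    exact hcorr _ l.succ_pos
  have hbound := measure_forall_eq_zero_le (Finset.nonempty_range_iff.2 hn.ne')
    (fun j _ ↦ hmemj j) hpos (fun j _ ↦ hmean j) hδ (fun j _ ↦ hvar j)
    (fun i _ j _ ↦ hcov i j)
  have hdiv : (∫ x, f x ∂μ) / (n * (∫ x, f x ∂μ) ^ 2) = 1 / (n * ∫ x, f x ∂μ) := by field_simp
  simpa only [Finset.mem_range, Finset.card_range, hdiv] using hbound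

end SecondMoment

section ShrinkingTargets

variable {X : Type*} [MetricSpace X]

theorem lipNorm_nonneg (f : X → ℝ) : 0 ≤ lipNorm f :=
  add_nonneg (Real.iSup_nonneg fun _ ↦ abs_nonneg _) (Real.sInf_nonneg fun _ h ↦ h.1)

theorem lipNorm_le {f : X → ℝ} {M K : ℝ} (hM : 0 ≤ M) (hK : 0 ≤ K) (hfM : ∀ x, |f x| ≤ M)
    (hfK : ∀ x y, |f x - f y| ≤ K * dist x y) : lipNorm f ≤ M + K :=
  add_le_add (Real.iSup_le hfM hM) (csInf_le ⟨0, fun _ h ↦ h.1⟩ ⟨hK, hfK⟩)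

theorem thickenedIndicator_mem_Icc {r : ℝ} (hr : 0 < r) (E : Set X) (x : X) :
    (thickenedIndicator hr E x : ℝ) ∈ Icc (0 : ℝ) 1 :=
  ⟨NNReal.coe_nonneg _, NNReal.coe_le_one.2 (thickenedIndicator_le_one hr E x)⟩

theorem abs_thickenedIndicator_le_one {r : ℝ} (hr : 0 < r) (E : Set X) (x : X) :
    |(thickenedIndicator hr E x : ℝ)| ≤ 1 := by
  rw [NNReal.abs_eq]
  exact (thickenedIndicator_mem_Icc hr E x).2

theorem abs_thickenedIndicator_sub_le {r : ℝ} (hr : 0 < r) (E : Set X) (x y : X) :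
    |(thickenedIndicator hr E x : ℝ) - thickenedIndicator hr E y| ≤ r⁻¹ * dist x y := by
  have h := (lipschitzWith_thickenedIndicator hr E).dist_le_mul x y
  rwa [NNReal.dist_eq, NNReal.coe_inv, Real.coe_toNNReal r hr.le] at h

theorem setOf_forall_add_le_dist_subset (T : X → X) (p : X) (r s : ℝ) {l : ℕ} (hl : 0 < l) (N : ℕ) :
    {x | ∀ j < N, r + s ≤ dist (T^[j] x) p} ⊆
      {x | ∀ j < N ⌈/⌉ l, T^[l * j] x ∉ Metric.thickening r (Metric.ball p s)} := by
  intro x hx j hj hmem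
  have hlj : l * j < N := (lt_iff_lt_of_le_iff_le (ceilDiv_le_iff_le_smul hl)).1 hj
  exact (hx (l * j) hlj).not_gt (Metric.thickening_ball p r s hmem)

variable [MeasurableSpace X] [OpensMeasurableSpace X] {μ : Measure X} {T : X → X}

theorem measureReal_le_integral_thickenedIndicator [IsFiniteMeasure μ] {r : ℝ} (hr : 0 < r)
    {E : Set X} (hE : MeasurableSet E) :
    μ.real E ≤ ∫ x, (thickenedIndicator hr E x : ℝ) ∂μ := by
  rw [← BoundedContinuousFunction.toReal_lintegral_coe_eq_integral]
  exact ENNReal.toReal_mono (BoundedContinuousFunction.lintegral_lt_top_of_nnreal μ _).ne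
    (measure_le_lintegral_thickenedIndicator μ hE hr)

theorem ExpDecayOfCorrelations.exists_measure_forall_notMem_thickening_le [IsProbabilityMeasure μ]
    (hA : ExpDecayOfCorrelations T μ) (hT : MeasurePreserving T μ μ) :
    ∃ C θ : ℝ, 0 < C ∧ 0 < θ ∧ θ < 1 ∧
      ∀ (E : Set X) (r M : ℝ) (l n : ℕ), 0 < r → r ≤ 1 → 0 < M →
      MeasurableSet E → M ≤ μ.real E → 0 < n →
      μ {x | ∀ j < n, T^[l * j] x ∉ Metric.thickening r E} ≤
        ENNReal.ofReal (1 / (n * M) + C * θ ^ l / (r ^ 2 * M ^ 2)) := by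
  obtain ⟨C, θ, hC, hθ, hθ1, hcorr⟩ := hA
  refine ⟨4 * C, θ, by positivity, hθ, hθ1, fun E r M l n hr hr1 hM hE hME hn ↦ ?_⟩
  set f : X → ℝ := fun x ↦ thickenedIndicator hr E x
  have hfM := abs_thickenedIndicator_le_one hr E
  have hfK := abs_thickenedIndicator_sub_le hr E
  have hf : IsBddLipschitz f := ⟨⟨1, hfM⟩, r⁻¹, by positivity, hfK⟩
  have hnorm : lipNorm f ≤ 2 / r := by
    have hr1' : 1 ≤ r⁻¹ := (one_le_inv₀ hr).2 hr1
    grw [lipNorm_le zero_le_one (by positivity) hfM hfK, hr1', ← two_mul, div_eq_mul_inv]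
  have hMf : M ≤ ∫ x, f x ∂μ := hME.trans (measureReal_le_integral_thickenedIndicator hr hE)
  have hdecay (j : ℕ) (hj : 0 < j) :
      ∫ x, f x * f ((T^[l])^[j] x) ∂μ - (∫ x, f x ∂μ) * ∫ x, f x ∂μ ≤
        C * θ ^ l * (2 / r) * (2 / r) := by
    rw [← Function.iterate_mul]
    have hθl : θ ^ (l * j) ≤ θ ^ l :=
      pow_le_pow_of_le_one hθ.le hθ1.le (Nat.le_mul_of_pos_right l hj)
    have hnonneg := lipNorm_nonneg f
    refine (le_abs_self _).trans ((hcorr f f hf hf (l * j)).trans ?_)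
    gcongr
  calc μ {x | ∀ j < n, T^[l * j] x ∉ Metric.thickening r E}
      ≤ μ {x | ∀ j < n, f ((T^[l])^[j] x) = 0} := by
        refine measure_mono fun x hx j hj ↦ NNReal.coe_eq_zero.2 (thickenedIndicator_zero hr E ?_)
        rw [← Function.iterate_mul]
        exact hx j hj
    _ ≤ ENNReal.ofReal (1 / (n * ∫ x, f x ∂μ) +
          C * θ ^ l * (2 / r) * (2 / r) / (∫ x, f x ∂μ) ^ 2) :=
        measure_forall_iterate_eq_zero_le (hT.iterate l) (by fun_prop)
          (thickenedIndicator_mem_Icc hr E) (hM.trans_le hMf) (by positivity) hdecay hn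
    _ ≤ ENNReal.ofReal (1 / (n * M) + C * θ ^ l * (2 / r) * (2 / r) / M ^ 2) := by gcongr
    _ = ENNReal.ofReal (1 / (n * M) + 4 * C * θ ^ l / (r ^ 2 * M ^ 2)) := by
        congr 2
        field_simp
        ring

variable {p : X} {β : ℝ}

-- Sampling the orbit every `l` steps leaves `N / l` samples with correlations of order `θ ^ l`.
theorem ExpDecayOfCorrelations.exists_measure_forall_le_dist_le [IsProbabilityMeasure μ]
    (hA : ExpDecayOfCorrelations T μ) (hT : MeasurePreserving T μ μ)
    (hμ : IsLowerRegularAt μ p β) :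
    ∃ C θ : ℝ, 0 < C ∧ 0 < θ ∧ θ < 1 ∧ ∀ᶠ r in 𝓝[>] (0 : ℝ), ∀ l N : ℕ, 0 < l → 0 < N →
      μ {x | ∀ j < N, r ≤ dist (T^[j] x) p} ≤
        ENNReal.ofReal (C * (l / (N * r ^ β) + θ ^ l / r ^ (2 * β + 2))) := by
  obtain ⟨C, θ, hC, hθ, hθ1, hmeas⟩ := hA.exists_measure_forall_notMem_thickening_le hT
  obtain ⟨c, hc, hball⟩ := hμ
  set c' := c * (1 / 2) ^ β
  have hc' : 0 < c' := by positivity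
  refine ⟨1 / c' + 4 * C / c' ^ 2, θ, by positivity, hθ, hθ1, ?_⟩
  filter_upwards [eventually_nhdsGT_zero_mul_left one_half_pos hball, self_mem_nhdsWithin,
    nhdsWithin_le_nhds (eventually_le_nhds one_pos)] with r hr hr0 hr1 l N hl hN
  rw [mem_Ioi] at hr0
  have hM : c * (1 / 2 * r) ^ β = c' * r ^ β := by
    rw [Real.mul_rpow one_half_pos.le hr0.le, mul_assoc]
  rw [hM] at hr
  set n := N ⌈/⌉ l
  have hn : 0 < n := (lt_iff_lt_of_le_iff_le (ceilDiv_le_iff_le_smul hl)).2 (by simpa)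
  have hNn : (N : ℝ) ≤ l * n := mod_cast le_smul_ceilDiv hl
  have hsub := setOf_forall_add_le_dist_subset T p (1 / 2 * r) (1 / 2 * r) hl N
  rw [← add_mul, add_halves, one_mul] at hsub
  have hinv : 1 / (n * (c' * r ^ β)) ≤ l / (N * (c' * r ^ β)) := by
    rw [div_le_div_iff₀ (by positivity) (by positivity), one_mul, ← mul_assoc (l : ℝ)]
    gcongr
  have hpow : r ^ (2 * β + 2) = (r ^ β) ^ 2 * r ^ 2 := by
    rw [Real.rpow_add hr0, mul_comm 2 β, Real.rpow_mul hr0.le, Real.rpow_two, Real.rpow_two]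
  calc μ {x | ∀ j < N, r ≤ dist (T^[j] x) p}
      ≤ μ {x | ∀ j < n, T^[l * j] x ∉
          Metric.thickening (1 / 2 * r) (Metric.ball p (1 / 2 * r))} :=
        measure_mono hsub
    _ ≤ ENNReal.ofReal (1 / (n * (c' * r ^ β)) +
          C * θ ^ l / ((1 / 2 * r) ^ 2 * (c' * r ^ β) ^ 2)) :=
        hmeas _ _ _ _ _ (by positivity) (by linarith) (by positivity)
          Metric.isOpen_ball.measurableSet
          ((ENNReal.ofReal_le_iff_le_toReal (measure_ne_top _ _)).1 hr) hn
    _ ≤ ENNReal.ofReal (l / (N * (c' * r ^ β)) +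
          C * θ ^ l / ((1 / 2 * r) ^ 2 * (c' * r ^ β) ^ 2)) := by grw [hinv]
    _ = ENNReal.ofReal (1 / c' * (l / (N * r ^ β)) +
          4 * C / c' ^ 2 * (θ ^ l / r ^ (2 * β + 2))) := by
        rw [hpow]
        congr 1
        field_simp
        ring
    _ ≤ ENNReal.ofReal ((1 / c' + 4 * C / c' ^ 2) *
          (l / (N * r ^ β) + θ ^ l / r ^ (2 * β + 2))) := by
        rw [mul_add]
        gcongr
        · exact le_add_of_nonneg_right (by positivity)
        · exact le_add_of_nonneg_left (by positivity)

theorem inv_two_pow_le_cube_div_two_pow {i : ℕ} (hi : 1 ≤ i) :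
    ((2 : ℝ) ^ i)⁻¹ ≤ (i : ℝ) ^ 3 / 2 ^ i := by
  rw [inv_eq_one_div]
  gcongr
  exact one_le_pow₀ (Nat.one_le_cast.2 hi)

theorem tendsto_cube_div_two_pow_rpow_nhdsGT_zero {s : ℝ} (hs : 0 < s) :
    Tendsto (fun i : ℕ ↦ ((i : ℝ) ^ 3 / 2 ^ i) ^ s) atTop (𝓝[>] 0) := by
  refine tendsto_nhdsWithin_iff.2 ⟨?_, ?_⟩
  · simpa only [Real.zero_rpow hs.ne'] using
      (tendsto_pow_const_div_const_pow_of_one_lt 3 one_lt_two).rpow_const (.inr hs.le)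
  · filter_upwards [eventually_gt_atTop 0] with i hi
    exact mem_Ioi.2 (by positivity)

theorem exists_pow_mul_div_cube_div_two_pow_rpow_le {θ : ℝ} (hθ : 0 < θ) (hθ1 : θ < 1) {γ : ℝ}
    (hγ : 0 ≤ γ) :
    ∃ A > 0, ∀ i : ℕ, 1 ≤ i → θ ^ (A * i) / ((i : ℝ) ^ 3 / 2 ^ i) ^ γ ≤ (1 / 2) ^ i := by
  set b : ℝ := 2 ^ γ
  obtain ⟨A, hA⟩ : ∃ A : ℕ, θ ^ A < (2 * b)⁻¹ := exists_pow_lt_of_lt_one (by positivity) hθ1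
  refine ⟨A + 1, Nat.succ_pos A, fun i hi ↦ ?_⟩
  have hθA : θ ^ (A + 1) ≤ (2 * b)⁻¹ := (pow_le_pow_of_le_one hθ.le hθ1.le A.le_succ).trans hA.le
  calc θ ^ ((A + 1) * i) / ((i : ℝ) ^ 3 / 2 ^ i) ^ γ
      ≤ ((2 * b)⁻¹) ^ i / (((2 : ℝ) ^ i)⁻¹) ^ γ := by
        rw [pow_mul]
        have := inv_two_pow_le_cube_div_two_pow hi
        gcongr
    _ = (1 / 2) ^ i := by
        rw [Real.inv_rpow (by positivity), div_inv_eq_mul, ← Real.rpow_pow_comm two_pos.le,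
          ← mul_pow, mul_inv, inv_mul_cancel_right₀ (by positivity), one_div]

theorem ExpDecayOfCorrelations.exists_measure_forall_cube_div_two_pow_le_dist_le
    [IsProbabilityMeasure μ] (hA : ExpDecayOfCorrelations T μ) (hT : MeasurePreserving T μ μ)
    (hβ : 0 < β) (hμ : IsLowerRegularAt μ p β) :
    ∃ C A : ℝ, ∀ᶠ i : ℕ in atTop,
      μ {x | ∀ j < 2 ^ i, ((i : ℝ) ^ 3 / 2 ^ i) ^ β⁻¹ ≤ dist (T^[j] x) p} ≤
        ENNReal.ofReal (C * (A * ((i : ℝ) ^ 2)⁻¹ + (1 / 2) ^ i)) := by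
  obtain ⟨C, θ, hC, hθ, hθ1, hmeas⟩ := hA.exists_measure_forall_le_dist_le hT hμ
  obtain ⟨A, hA0, hA⟩ :=
    exists_pow_mul_div_cube_div_two_pow_rpow_le hθ hθ1 (γ := β⁻¹ * (2 * β + 2)) (by positivity)
  refine ⟨C, A, ?_⟩
  filter_upwards [(tendsto_cube_div_two_pow_rpow_nhdsGT_zero (inv_pos.2 hβ)).eventually hmeas,
    eventually_ge_atTop 1] with i hi hi1
  have hq : (0 : ℝ) ≤ (i : ℝ) ^ 3 / 2 ^ i := by positivity
  refine (hi (A * i) (2 ^ i) (by positivity) (by positivity)).trans ?_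
  rw [Real.rpow_inv_rpow hq hβ.ne', ← Real.rpow_mul hq]
  gcongr ENNReal.ofReal (C * (?_ + ?_))
  · push_cast
    refine le_of_eq ?_
    field_simp
  · exact hA i hi1

theorem ExpDecayOfCorrelations.ae_eventually_exists_dist_lt [IsProbabilityMeasure μ]
    (hA : ExpDecayOfCorrelations T μ) (hT : MeasurePreserving T μ μ) (hβ : 0 < β)
    (hμ : IsLowerRegularAt μ p β) :
    ∀ᵐ x ∂μ, ∀ᶠ i : ℕ in atTop, ∃ j < 2 ^ i,
      dist (T^[j] x) p < ((i : ℝ) ^ 3 / 2 ^ i) ^ β⁻¹ := by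
  obtain ⟨C, A, hmeas⟩ := hA.exists_measure_forall_cube_div_two_pow_le_dist_le hT hβ hμ
  have hsum : Summable fun i : ℕ ↦ C * (A * ((i : ℝ) ^ 2)⁻¹ + (1 / 2) ^ i) :=
    (((Real.summable_nat_pow_inv.2 one_lt_two).mul_left A).add summable_geometric_two).mul_left C
  filter_upwards [ae_eventually_notMem
    (tsum_ne_top_of_eventually_le_ofReal (fun _ ↦ measure_ne_top μ _) hsum hmeas)] with x hx
  simpa only [mem_ofPred_eq, not_forall, not_le, exists_prop] using hx

end ShrinkingTargets

section Asymptotics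

open Asymptotics

variable {u : ℕ → ℝ} {s γ γ' : ℝ}

theorem tendsto_log_natCast_atTop : Tendsto (fun n : ℕ ↦ Real.log n) atTop atTop :=
  Real.tendsto_log_atTop.comp tendsto_natCast_atTop_atTop

theorem eventually_rpow_mul_log_rpow_pos (s γ : ℝ) :
    ∀ᶠ n : ℕ in atTop, 0 < (n : ℝ) ^ s * Real.log n ^ γ := by
  filter_upwards [eventually_gt_atTop 0, tendsto_log_natCast_atTop.eventually_gt_atTop 0]
    with n hn hlog
  positivity

theorem isLittleO_rpow_rpow_atTop_of_lt (h : γ < γ') :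
    (fun x : ℝ ↦ x ^ γ) =o[atTop] fun x : ℝ ↦ x ^ γ' := by
  refine isLittleO_of_tendsto' ?_ ((tendsto_rpow_neg_atTop (sub_pos.2 h)).congr' ?_)
  · filter_upwards [eventually_gt_atTop 0] with x hx hzero
    exact absurd hzero (by positivity)
  · filter_upwards [eventually_gt_atTop 0] with x hx
    rw [neg_sub, Real.rpow_sub hx]

theorem isLittleO_rpow_mul_log_rpow (s : ℝ) (h : γ < γ') :
    (fun n : ℕ ↦ (n : ℝ) ^ s * Real.log n ^ γ) =o[atTop]
      fun n : ℕ ↦ (n : ℝ) ^ s * Real.log n ^ γ' :=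
  (isBigO_refl _ _).mul_isLittleO
    ((isLittleO_rpow_rpow_atTop_of_lt h).comp_tendsto tendsto_log_natCast_atTop)

theorem isLittleO_rpow_mul_exp_neg_log_rpow (hs : 0 < s) {c : ℝ} (hc : 0 < c) (γ : ℝ) :
    (fun n : ℕ ↦ (n : ℝ) ^ s * Real.exp (-(Real.log n ^ c)) ^ s) =o[atTop]
      fun n : ℕ ↦ (n : ℝ) ^ s * Real.log n ^ γ := by
  refine (isBigO_refl _ _).mul_isLittleO
    (((isLittleO_exp_neg_mul_rpow_atTop hs (γ / c)).comp_tendsto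
      ((tendsto_rpow_atTop hc).comp tendsto_log_natCast_atTop)).congr (fun n ↦ ?_) fun n ↦ ?_)
  · simp only [Function.comp_apply, ← Real.exp_mul, neg_mul, mul_comm s]
  · simp only [Function.comp_apply, ← Real.rpow_mul (Real.log_natCast_nonneg n),
      mul_div_cancel₀ _ hc.ne']

theorem limsup_coe_div_eq_zero {f : ℕ → ℝ} (hu : u =o[atTop] f) :
    limsup (fun n ↦ ((u n / f n : ℝ) : EReal)) atTop = 0 :=
  ((continuous_coe_real_ereal.tendsto 0).comp hu.tendsto_div_nhds_zero).limsup_eq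

theorem liminf_coe_div_eq_top {f : ℕ → ℝ} (hfu : f =o[atTop] u) (hf : ∀ᶠ n in atTop, 0 < f n)
    (hu : ∀ᶠ n in atTop, 0 < u n) :
    liminf (fun n ↦ ((u n / f n : ℝ) : EReal)) atTop = ⊤ := by
  have hzero : Tendsto (fun n ↦ f n / u n) atTop (𝓝[>] 0) := by
    refine tendsto_nhdsWithin_iff.2 ⟨hfu.tendsto_div_nhds_zero, ?_⟩
    filter_upwards [hf, hu] with n hfn hun using div_pos hfn hun
  have htop : Tendsto (fun n ↦ u n / f n) atTop atTop :=
    hzero.inv_tendsto_nhdsGT_zero.congr fun n ↦ inv_div _ _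
  exact (EReal.tendsto_coe_nhds_top_iff.2 htop).liminf_eq

theorem tendsto_log_const_mul_rpow_mul_log_rpow_div_log {c : ℝ} (hc : 0 < c) (s γ : ℝ) :
    Tendsto (fun n : ℕ ↦ Real.log (c * ((n : ℝ) ^ s * Real.log n ^ γ)) / Real.log n) atTop
      (𝓝 s) := by
  have hinv : Tendsto (fun n : ℕ ↦ Real.log c / Real.log n) atTop (𝓝 0) :=
    tendsto_log_natCast_atTop.const_div_atTop _
  have hloglog : Tendsto (fun n : ℕ ↦ Real.log (Real.log n) / Real.log n) atTop (𝓝 0) :=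
    Real.isLittleO_log_id_atTop.tendsto_div_nhds_zero.comp tendsto_log_natCast_atTop
  have hsum : Tendsto (fun n : ℕ ↦ Real.log c / Real.log n +
      (s + γ * (Real.log (Real.log n) / Real.log n))) atTop (𝓝 s) := by
    simpa only [mul_zero, add_zero, zero_add] using hinv.add ((hloglog.const_mul γ).const_add s)
  refine hsum.congr' ?_
  filter_upwards [eventually_gt_atTop 0, tendsto_log_natCast_atTop.eventually_gt_atTop 0]
    with n hn hlog
  rw [Real.log_mul (by positivity) (by positivity), Real.log_mul (by positivity) (by positivity),
    Real.log_rpow (by positivity), Real.log_rpow hlog]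
  field_simp

theorem eventually_pos_of_isBigO {f : ℕ → ℝ} (hu : ∀ n, 0 ≤ u n) (hf : ∀ᶠ n in atTop, 0 < f n)
    (hfu : f =O[atTop] u) : ∀ᶠ n in atTop, 0 < u n := by
  filter_upwards [hf, hfu.eq_zero_imp] with n hfn hzero
  exact (hu n).lt_of_ne fun h ↦ hfn.ne' (hzero h.symm)

theorem tendsto_log_div_log_of_isBigO (hu : ∀ n, 0 ≤ u n)
    (hlow : (fun n : ℕ ↦ (n : ℝ) ^ s * Real.log n ^ γ) =O[atTop] u)
    (hup : u =O[atTop] fun n : ℕ ↦ (n : ℝ) ^ s * Real.log n ^ γ') :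
    Tendsto (fun n : ℕ ↦ Real.log (u n) / Real.log n) atTop (𝓝 s) := by
  obtain ⟨c, hc, hlow'⟩ := hlow.exists_pos
  obtain ⟨C, hC, hup'⟩ := hup.exists_pos
  refine tendsto_of_tendsto_of_tendsto_of_le_of_le'
    (tendsto_log_const_mul_rpow_mul_log_rpow_div_log (inv_pos.2 hc) s γ)
    (tendsto_log_const_mul_rpow_mul_log_rpow_div_log hC s γ') ?_ ?_
  · filter_upwards [hlow'.bound, eventually_rpow_mul_log_rpow_pos s γ] with n hn hpos
    rw [Real.norm_of_nonneg hpos.le, Real.norm_of_nonneg (hu n), ← inv_mul_le_iff₀ hc] at hn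
    have := Real.log_natCast_nonneg n
    gcongr
  · filter_upwards [hup'.bound, eventually_rpow_mul_log_rpow_pos s γ',
      eventually_pos_of_isBigO hu (eventually_rpow_mul_log_rpow_pos s γ) hlow] with n hn hpos hun
    rw [Real.norm_of_nonneg hpos.le, Real.norm_of_nonneg hun.le] at hn
    have := Real.log_natCast_nonneg n
    gcongr

end Asymptotics

section CloseApproach

open Asymptotics

theorem rpow_neg_le_distBirkhoffSum {X : Type*} [MetricSpace X] {T : X → X} {p x : X} {k r : ℝ}
    {j n : ℕ} (hk : 0 ≤ k) (hj : j < n) (hne : T^[j] x ≠ p) (hr : dist (T^[j] x) p ≤ r) :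
    r ^ (-k) ≤ distBirkhoffSum T p k n x :=
  (Real.rpow_le_rpow_of_nonpos (dist_pos.2 hne) hr (neg_nonpos.2 hk)).trans
    (Finset.single_le_sum (f := fun j ↦ dist (T^[j] x) p ^ (-k))
      (fun _ _ ↦ Real.rpow_nonneg dist_nonneg _) (Finset.mem_range.2 hj))

theorem div_log_cube_le_two_pow_natLog_div_cube {n : ℕ} (hn : 2 ≤ n) :
    (n : ℝ) / Real.log n ^ 3 ≤ 16 * (2 ^ Nat.log 2 n / (Nat.log 2 n : ℝ) ^ 3) := by
  have hi : 0 < Nat.log 2 n := Nat.log_pos one_lt_two hn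
  have hlog : 0 < Real.log n := Real.log_pos (by exact_mod_cast hn)
  have hpow : (n : ℝ) ≤ 2 * 2 ^ Nat.log 2 n := by
    rw [← pow_succ']
    exact_mod_cast (Nat.lt_pow_succ_log_self one_lt_two n).le
  have hilog : (Nat.log 2 n : ℝ) ≤ 2 * Real.log n := by
    grw [Real.natLog_le_logb, Nat.cast_ofNat, Real.logb, div_le_iff₀ (Real.log_pos one_lt_two)]
    nlinarith [Real.log_two_gt_d9]
  rw [← mul_div_assoc, div_le_div_iff₀ (by positivity) (by positivity)]
  calc (n : ℝ) * (Nat.log 2 n : ℝ) ^ 3 ≤ 2 * 2 ^ Nat.log 2 n * (2 * Real.log n) ^ 3 := by gcongr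
    _ = 16 * 2 ^ Nat.log 2 n * Real.log n ^ 3 := by ring

theorem isBigO_distBirkhoffSum_of_eventually_exists_dist_lt {X : Type*} [MetricSpace X]
    {T : X → X} {p x : X} {β k : ℝ} (hβ : 0 < β) (hk : 0 ≤ k) (hne : ∀ j : ℕ, T^[j] x ≠ p)
    (hx : ∀ᶠ i : ℕ in atTop, ∃ j < 2 ^ i, dist (T^[j] x) p < ((i : ℝ) ^ 3 / 2 ^ i) ^ β⁻¹) :
    (fun n : ℕ ↦ (n : ℝ) ^ (k / β) * Real.log n ^ (-(3 * (k / β)))) =O[atTop]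
      fun n ↦ distBirkhoffSum T p k n x := by
  have hlog2 : Tendsto (Nat.log 2) atTop atTop :=
    tendsto_atTop_atTop_of_monotone Nat.log_monotone fun i ↦ ⟨2 ^ i, (Nat.log_pow one_lt_two i).ge⟩
  refine .of_bound (16 ^ (k / β)) ?_
  filter_upwards [hlog2.eventually hx, eventually_ge_atTop 2] with n ⟨j, hj, hdist⟩ hn
  have hlog := Real.log_natCast_nonneg n
  rw [Real.norm_of_nonneg (by positivity),
    Real.norm_of_nonneg (distBirkhoffSum_nonneg T p k n x)]
  set i := Nat.log 2 n
  calc (n : ℝ) ^ (k / β) * Real.log n ^ (-(3 * (k / β)))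
      = (n / Real.log n ^ 3) ^ (k / β) := by
        rw [Real.rpow_neg hlog, Real.rpow_mul hlog, ← div_eq_mul_inv,
          Real.div_rpow n.cast_nonneg (by positivity), Real.rpow_ofNat]
    _ ≤ (16 * (2 ^ i / (i : ℝ) ^ 3)) ^ (k / β) := by
        grw [div_log_cube_le_two_pow_natLog_div_cube hn]
    _ = 16 ^ (k / β) * (((i : ℝ) ^ 3 / 2 ^ i) ^ β⁻¹) ^ (-k) := by
        rw [Real.mul_rpow (by norm_num) (by positivity), ← Real.rpow_mul (by positivity),
          ← inv_div ((i : ℝ) ^ 3), Real.inv_rpow (by positivity), ← Real.rpow_neg (by positivity)]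
        congr 2
        ring
    _ ≤ 16 ^ (k / β) * distBirkhoffSum T p k n x := by
        have hjn : j < n := hj.trans_le (Nat.pow_log_le_self 2 (by lia))
        grw [rpow_neg_le_distBirkhoffSum hk hjn (hne j) hdist.le]

theorem ExpDecayOfCorrelations.ae_isBigO_distBirkhoffSum {X : Type*} [MetricSpace X]
    [MeasurableSpace X] [OpensMeasurableSpace X] {μ : Measure X} [IsProbabilityMeasure μ]
    {T : X → X} {p : X} {β k : ℝ} (hA : ExpDecayOfCorrelations T μ) (hT : MeasurePreserving T μ μ)
    (hβ : 0 < β) (hk : 0 ≤ k) (hp : μ {p} = 0) (hμ : IsLowerRegularAt μ p β) :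
    ∀ᵐ x ∂μ, (fun n : ℕ ↦ (n : ℝ) ^ (k / β) * Real.log n ^ (-(3 * (k / β)))) =O[atTop]
      fun n ↦ distBirkhoffSum T p k n x := by
  have hne : ∀ᵐ x ∂μ, ∀ j : ℕ, T^[j] x ≠ p := ae_all_iff.2 fun j ↦
    (hT.iterate j).quasiMeasurePreserving.ae (measure_eq_zero_iff_ae_notMem.1 hp)
  filter_upwards [hne, hA.ae_eventually_exists_dist_lt hT hβ hμ] with x hxp hx
  exact isBigO_distBirkhoffSum_of_eventually_exists_dist_lt hβ hk hxp hx

end CloseApproach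

theorem theorem4_general {X : Type*} [MetricSpace X] [MeasurableSpace X] [OpensMeasurableSpace X]
    {T : X → X} {μ : Measure X} [IsProbabilityMeasure μ] (hT : MeasurePreserving T μ μ)
    (hA : ExpDecayOfCorrelations T μ) {p : X} {β k : ℝ} (hβ : 0 < β) (hk : β ≤ k)
    (hup : IsUpperRegularAt μ p β) (hlow : IsLowerRegularAt μ p β) :
    (∀ ε : ℝ, 0 < ε → ∀ᵐ x ∂μ,
      limsup (fun n : ℕ ↦ ((distBirkhoffSum T p k n x /
        ((n : ℝ) ^ (k / β) * Real.log n ^ (k / β + ε)) : ℝ) : EReal)) atTop = 0) ∧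
    (∀ ε : ℝ, 0 < ε → ∀ᵐ x ∂μ,
      1 < liminf (fun n : ℕ ↦ ((distBirkhoffSum T p k n x /
        ((n : ℝ) ^ (k / β) *
          Real.exp (-(Real.log n ^ (1 / 2 + ε))) ^ (k / β)) : ℝ) : EReal)) atTop) ∧
    (∀ᵐ x ∂μ, Tendsto (fun n : ℕ ↦ Real.log (distBirkhoffSum T p k n x) / Real.log n) atTop
      (𝓝 (k / β))) := by
  have hs : 0 < k / β := div_pos (hβ.trans_le hk) hβ
  have hlower := hA.ae_isBigO_distBirkhoffSum hT hβ (hβ.le.trans hk)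
    (hup.measure_singleton_eq_zero hβ) hlow
  refine ⟨fun ε hε ↦ ?_, fun ε hε ↦ ?_, ?_⟩
  · filter_upwards [hup.ae_distBirkhoffSum_isBigO hT hβ hk (half_pos hε)] with x hx
    exact limsup_coe_div_eq_zero
      (hx.trans_isLittleO (isLittleO_rpow_mul_log_rpow _ (by linarith)))
  · filter_upwards [hlower] with x hx
    have hpos : ∀ᶠ n : ℕ in atTop,
        0 < (n : ℝ) ^ (k / β) * Real.exp (-(Real.log n ^ (1 / 2 + ε))) ^ (k / β) := by
      filter_upwards [eventually_gt_atTop 0] with n hn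
      positivity
    have hrate := isLittleO_rpow_mul_exp_neg_log_rpow hs (by positivity : 0 < 1 / 2 + ε)
      (-(3 * (k / β)))
    rw [liminf_coe_div_eq_top (hrate.trans_isBigO hx) hpos (eventually_pos_of_isBigO
      (distBirkhoffSum_nonneg T p k · x) (eventually_rpow_mul_log_rpow_pos _ _) hx)]
    exact EReal.coe_lt_top 1
  · filter_upwards [hlower, hup.ae_distBirkhoffSum_isBigO hT hβ hk one_pos] with x hxl hxu
    exact tendsto_log_div_log_of_isBigO (distBirkhoffSum_nonneg T p k · x) hxl hxu

theorem theorem4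
    -- a `D`-dimensional Riemannian manifold, possibly with boundary or corners, with its
    -- Riemannian distance; `μHE[D]` is then the Riemannian volume
    {E : Type*} [NormedAddCommGroup E] [NormedSpace ℝ E] [FiniteDimensional ℝ E]
    {H : Type*} [TopologicalSpace H] (I : ModelWithCorners ℝ E H)
    {X : Type*} [MetricSpace X] [ChartedSpace H X] [IsManifold I 1 X]
    [Bundle.RiemannianBundle (fun x : X => TangentSpace I x)]
    [IsContinuousRiemannianBundle E (fun x : X => TangentSpace I x)]
    [IsRiemannianManifold I X]
    [MeasurableSpace X] [BorelSpace X]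
    (D : ℕ) (hD : Module.finrank ℝ E = D)
    (T : X → X) (μ : Measure X) [IsProbabilityMeasure μ] (hT : Ergodic T μ)
    (hA : ExpDecayOfCorrelations T μ) (hB : ThinAnnuli μ)
    (h : X → ℝ) (hh : Measurable h) (hh0 : ∀ x, 0 ≤ h x)
    (hμ : μ = (μHE[D] : Measure X).withDensity (fun x => ENNReal.ofReal (h x)))
    (p : X) (α k : ℝ) (hα : 0 < α) (hαD : α < D) (hk : D - α ≤ k)
    (hp : DensityComparableAt (μHE[D] : Measure X) h p α) :
    (∀ ε : ℝ, 0 < ε → ∀ᵐ x ∂μ,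
      limsup (fun n : ℕ => ((distBirkhoffSum T p k n x /
        ((n : ℝ) ^ (k / (D - α)) * Real.log n ^ (k / (D - α) + ε)) : ℝ) : EReal)) atTop = 0) ∧
    (∀ ε : ℝ, 0 < ε → ∀ᵐ x ∂μ,
      1 < liminf (fun n : ℕ => ((distBirkhoffSum T p k n x /
        ((n : ℝ) ^ (k / (D - α)) *
          Real.exp (-(Real.log n ^ (1 / 2 + ε))) ^ (k / (D - α))) : ℝ) : EReal)) atTop) ∧
    (∀ᵐ x ∂μ, Tendsto (fun n : ℕ => Real.log (distBirkhoffSum T p k n x) / Real.log n) atTop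
      (𝓝 (k / (D - α)))) := by
  subst hD hμ
  have hvol : IsUpperRegularAt (μHE[Module.finrank ℝ E] : Measure X) p (Module.finrank ℝ E) :=
    isUpperRegularAt_riemannianVolume I p
  exact theorem4_general hT.toMeasurePreserving hA (sub_pos.2 hαD) hk
    (hp.isUpperRegularAt_withDensity hα.le hαD hvol)
    (hp.isLowerRegularAt_withDensity hα.le (hvol.measure_singleton_eq_zero (hα.trans hαD))
      (isLowerRegularAt_riemannianVolume I p))
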